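/- Let $A$ be a finite set with the discrete topology, $A^{\mathbb N}$ (indices $0,1,2,\dots$) the space of one-sided sequences with the product topology and Borel $\sigma$-field, and $(Tx)(i)=x(i+1)$ the shift. Let $X\subset A^{\mathbb N}$ be a non-empty subshift (a compact set with $TX\subset X$). Let $\mathcal L_m(X)$ be the set of words $x(0)\cdots x(m)$, $x\in X$, and $\mathcal L^*(X)=\bigcup_{m\ge 0}\mathcal L_m(X)$; for a word $a$ of length $m+1$ let $[a]=\{x\in X: x(0)\cdots x(m)=a\}$. Assume that * $X$ is sofic, i.e. the collection of follower sets $\{b\in\mathcal L^*(X): ab\in\mathcal L^*(X)\}$, $a\in\mathcal L^*(X)$, is finite; * $X$ is specified, i.e. there is $\ell\ge 0$ such that for all $a\in\mathcal L_m(X)$, $b\in\mathcal L_n(X)$ and all $k,k'\ge\ell$ there is $c\in X$ with $T^{\,m+n+k+k'+2}c=c$, $c(0)\cdots c(m)=a$ and $c(m+k+1)\cdots c(m+k+n+1)=b$. Let $\phi:A^{\mathbb N}\to\mathbb R$ be Hölder continuous: there are $\theta\in[0,1)$, $C>0$ with $|\phi(x)-\phi(y)|\le C\theta^m$ whenever $x(i)=y(i)$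 for $0\le i\le m$, for all $m\ge 0$. A Gibbs measure for $\phi$ on a subshift $Y$ is a $T$-invariant Borel probability measure $\mu$ with $\mu(Y)=1$ for which there are $C>0$ and $P\in\mathbb R$ with $$C^{-1}\le \frac{\mu[x(0)\cdots x(k)]}{\exp\bigl(\sum_{i=0}^k\phi(T^ix)-(k+1)P\bigr)}\le C\qquad\text{for all }x\in Y,\ k\ge 0 ,$$ where $[\cdot]$ denotes cylinders of $Y$. For $m\ge 1$ let $X_m=\{x\in A^{\mathbb N}: x(j)\cdots x(j+m)\in\mathcal L_m(X)\text{ for all }j\ge 0\}$ be the finite type approximation of order $m$ to $X$. Then for each $m\ge1$ there is a unique Gibbs measure $\mu_\phi^m$ for $\phi$ on $X_m$, the sequence $(\mu_\phi^m)$ converges weakly, as $m\to\infty$, to a $T$-invariant probability measure $\mu^*$ with $\mu^*(X)=1$, and $\mu^*$ is strongly mixing in the following sense: there are a real polynomial $Q_\mu$ of degree $2$ and a constant $\theta_\mu\in(0,1)$ such that for all $a,b\in\mathcal L^*(X)$ there is $s^*=s^*(a,b)$ with $$\left|\frac{\mu^*\bigl([a]\cap T^{-s}[b]\bigr)}{\mu^*[a]\,\mu^*[b]}-1\right|\le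 Q_\mu(\sqrt s)\,\theta_\mu^{\sqrt s}\qquad\text{for all integers } s\ge s^* .$$ -/

import Mathlib

open MeasureTheory Filter Topology

namespace SoficGibbs

/-- The one-sided shift `T` on sequences: `(T x) i = x (i + 1)`. -/
def shift {A : Type*} (x : ℕ → A) : ℕ → A := fun i => x (i + 1)

/-- The word of length `n` read in the sequence `x` from position `i` on:
`x i, x (i + 1), …, x (i + n - 1)`. -/
def word {A : Type*} (x : ℕ → A) (i n : ℕ) : List A :=
  List.ofFn fun j : Fin n => x (i + j)

/-- A subshift: a compact set of sequences that is invariant under the shift. -/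
structure IsSubshift {A : Type*} [TopologicalSpace A] (X : Set (ℕ → A)) : Prop where
  isCompact : IsCompact X
  mapsTo : Set.MapsTo shift X X

/-- `admissible X m` is the set of words of length `m + 1` that are initial words of points
of `X`. -/
def admissible {A : Type*} (X : Set (ℕ → A)) (m : ℕ) : Set (List A) :=
  (fun x => word x 0 (m + 1)) '' X

/-- The language of `X`: all its admissible words (they are non-empty). -/
def language {A : Type*} (X : Set (ℕ → A)) : Set (List A) :=
  ⋃ n, admissible X n

/-- The followers of the word `a`. -/
def followers {A : Type*} (X : Set (ℕ → A)) (a : List A) : Set (List A) :=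
  {b | b ∈ language X ∧ a ++ b ∈ language X}

/-- `X` is sofic: its admissible words have only finitely many different follower sets. -/
def IsSofic {A : Type*} (X : Set (ℕ → A)) : Prop :=
  (followers X '' language X).Finite

/-- The cylinder of `X` determined by the word `a`. -/
def cylinder {A : Type*} (X : Set (ℕ → A)) (a : List A) : Set (ℕ → A) :=
  {x | x ∈ X ∧ word x 0 a.length = a}

/-- `X` is specified: for some `ℓ`, any two admissible words `a`, `b` and any two gaps
`k, k' ≥ ℓ` there is a periodic point of `X` whose period block consists of `a`, then `k` symbols,
then `b`, then `k'` symbols. -/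
def IsSpecified {A : Type*} (X : Set (ℕ → A)) : Prop :=
  ∃ l : ℕ, ∀ a ∈ language X, ∀ b ∈ language X, ∀ k k' : ℕ, l ≤ k → l ≤ k' →
    ∃ c ∈ X, Function.IsPeriodicPt shift (a.length + k + b.length + k') c ∧
      word c 0 a.length = a ∧ word c (a.length + k) b.length = b

/-- Hölder continuous potentials on the full shift. -/
def IsHolder {A : Type*} (φ : (ℕ → A) → ℝ) : Prop :=
  ∃ θ C : ℝ, 0 ≤ θ ∧ θ < 1 ∧ 0 < C ∧
    ∀ (m : ℕ) (x y : ℕ → A), (∀ i ≤ m, x i = y i) → |φ x - φ y| ≤ C * θ ^ m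

/-- The sum of `φ` along the orbit piece `x, T x, …, T^k x` (`k + 1` terms). -/
noncomputable def orbitSum {A : Type*} (φ : (ℕ → A) → ℝ) (k : ℕ) (x : ℕ → A) : ℝ :=
  ∑ i ∈ Finset.range (k + 1), φ (shift^[i] x)

/-- The shift-invariant probability measures that are carried by `X`. -/
structure IsInvariantOn {A : Type*} [MeasurableSpace A] (X : Set (ℕ → A))
    (μ : ProbabilityMeasure (ℕ → A)) : Prop where
  measurePreserving :
    MeasurePreserving shift (μ : Measure (ℕ → A)) (μ : Measure (ℕ → A))
  carried : (μ : Measure (ℕ → A)) X = 1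

/-- `μ` is a Gibbs measure on `X` for the potential `φ`. -/
def IsGibbs {A : Type*} [MeasurableSpace A] (X : Set (ℕ → A)) (φ : (ℕ → A) → ℝ)
    (μ : ProbabilityMeasure (ℕ → A)) : Prop :=
  IsInvariantOn X μ ∧
    ∃ C P : ℝ, 0 < C ∧ ∀ x ∈ X, ∀ k : ℕ,
      C⁻¹ ≤ (μ : Measure (ℕ → A)).real (cylinder X (word x 0 (k + 1))) /
          Real.exp (orbitSum φ k x - (k + 1) * P) ∧
      (μ : Measure (ℕ → A)).real (cylinder X (word x 0 (k + 1))) /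
          Real.exp (orbitSum φ k x - (k + 1) * P) ≤ C

/-- The finite type approximation of order `m` to `X`: the sequences all of whose subwords of
length `m + 1` are admissible for `X`. -/
def approx {A : Type*} (X : Set (ℕ → A)) (m : ℕ) : Set (ℕ → A) :=
  {x | ∀ j, word x j (m + 1) ∈ admissible X m}

end SoficGibbs

/-!
For a potential `φ` and a subshift `Y`, the transfer operator sums `exp φ * f` over the preimages in
`Y` of a point under the shift. It acts here on all functions, without continuity or measurability:
on a sofic shift it does not preserve the continuous ones.

**Existence.** The specification property of `X` gives a gap `l` such that any prefix of a point of
`X` can be joined to any other point of `X` by a word of length `l` (`IsGluing`), and all the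
approximations `approx X m` inherit this with the same `l` (`IsWordGluing.isGluing_approx`). Gluing
makes the partition functions at different points comparable (`partition_le_mul`), so that they grow
like `exp (n * P)` with uniform constants (`exists_pressure`). A Banach limit of the normalised
partition functions is a positive eigenfunction (`exists_isEigenfunction`), and normalising by it
turns the transfer operator into a Markov operator. A Banach limit along an orbit of this operator
is a stationary functional (`IsStationary`), which the Riesz–Markov–Kakutani theorem represents by
an invariant measure on `Y`. One preimage branch bounds the measure of a cylinder from both sides;
this is the Gibbs property, with constants that depend on `Y` only through `l`
(`exists_isGibbsWith`).

**Uniqueness and convergence.** Gluing and the Gibbs property make a Gibbs measure ergodic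
(`IsGibbsWith.ergodic`), and two Gibbs measures for `φ` are mutually absolutely continuous, hence
equal (`IsGibbsWith.eq`). As the constants are uniform in `m`, each weak limit point of the Gibbs
measures on `approx X m` is a Gibbs measure on `X`, and there is only one
(`tendsto_of_isGibbsWith_approx`).

**Mixing.** Points of the sofic shift `X` with the same left extensions have matching preimages, and
between such points the eigenfunction is log-Hölder. The normalised operator then satisfies a
Lasota–Yorke inequality (`HasOsc.transfer_pow`). A word with a minimal follower set is synchronising:
the points that start with it have the same left extensions
(`IsSofic.exists_synchronising`). Any two points have preimages that start with a long synchronising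
word, which gives a Doeblin condition. Both together contract oscillations exponentially
(`exists_contraction`). So the correlations between cylinders decay exponentially, with a prefactor
that depends on the first cylinder (`exists_isGibbsWith_mixing`); as the threshold `s₀` may depend on
the cylinders as well, this is stronger than the stretched exponential bound.
-/

/-! ### Sequences, words and Hölder potentials -/

namespace SoficGibbs

variable {A : Type*}

/-- The sequence `a, x 0, x 1, …`. -/
def cons (a : A) (x : ℕ → A) : ℕ → A
  | 0 => a
  | n + 1 => x n

/-- The sequence that starts with the word `w` and continues with `x`. -/
def join {n : ℕ} (w : Fin n → A) (x : ℕ → A) : ℕ → A :=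
  fun i => if h : i < n then w ⟨i, h⟩ else x (i - n)

@[simp] lemma shift_cons (a : A) (x : ℕ → A) : shift (cons a x) = x := rfl

@[simp] lemma cons_zero (a : A) (x : ℕ → A) : cons a x 0 = a := rfl

@[simp] lemma cons_succ (a : A) (x : ℕ → A) (n : ℕ) : cons a x (n + 1) = x n := rfl

lemma cons_shift (x : ℕ → A) : cons (x 0) (shift x) = x := by
  funext n; cases n <;> rfl

lemma shift_iterate_apply (n : ℕ) (x : ℕ → A) (i : ℕ) : shift^[n] x i = x (i + n) := by
  induction n generalizing x with
  | zero => rfl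
  | succ n ih => rw [Function.iterate_succ_apply, ih]; simp [shift, Nat.add_assoc]

lemma join_of_lt {n : ℕ} (w : Fin n → A) (x : ℕ → A) {i : ℕ} (h : i < n) :
    join w x i = w ⟨i, h⟩ := dif_pos h

lemma join_add {n : ℕ} (w : Fin n → A) (x : ℕ → A) (i : ℕ) : join w x (i + n) = x i := by
  simp [join]

@[simp] lemma shift_iterate_join {n : ℕ} (w : Fin n → A) (x : ℕ → A) :
    shift^[n] (join w x) = x := by
  funext i; rw [shift_iterate_apply, join_add]

lemma join_prefix (z : ℕ → A) (n : ℕ) : join (fun i : Fin n => z i) (shift^[n] z) = z := by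
  funext i
  by_cases h : i < n
  · rw [join_of_lt _ _ h]
  · obtain ⟨j, rfl⟩ := Nat.exists_eq_add_of_le' (not_lt.1 h)
    rw [join_add, shift_iterate_apply]

@[simp] lemma join_zero (w : Fin 0 → A) (x : ℕ → A) : join w x = x := by
  funext i; simp [join]

lemma join_cons {n : ℕ} (a : A) (w : Fin n → A) (x : ℕ → A) :
    join (Fin.cons a w : Fin (n + 1) → A) x = cons a (join w x) := by
  funext i
  cases i with
  | zero => simp [join]
  | succ i =>
    by_cases h : i < n
    · rw [join_of_lt _ _ (Nat.succ_lt_succ h), cons_succ, join_of_lt _ _ h]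
      exact Fin.cons_succ (α := fun _ => A) a w ⟨i, h⟩
    · simp [join, h]

@[simp] lemma length_word (x : ℕ → A) (i n : ℕ) : (word x i n).length = n := by simp [word]

lemma word_eq_word_iff {x y : ℕ → A} {i j n : ℕ} :
    word x i n = word y j n ↔ ∀ k < n, x (i + k) = y (j + k) := by
  simp only [word, List.ofFn_inj, funext_iff]
  exact ⟨fun h k hk => h ⟨k, hk⟩, fun h k => h k k.2⟩

lemma word_zero_eq_iff {x y : ℕ → A} {n : ℕ} :
    word x 0 n = word y 0 n ↔ x ∈ PiNat.cylinder y n := by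
  simp [word_eq_word_iff, PiNat.mem_cylinder_iff]

lemma word_shift (x : ℕ → A) (i j n : ℕ) : word (shift^[i] x) j n = word x (i + j) n := by
  rw [word_eq_word_iff]; intro k _; rw [shift_iterate_apply]; congr 1; ring

lemma word_append (x : ℕ → A) (i m n : ℕ) : word x i m ++ word x (i + m) n = word x i (m + n) := by
  refine List.ext_getElem (by simp) fun k h₁ h₂ => ?_
  simp only [word, List.getElem_append, List.length_ofFn, List.getElem_ofFn]
  split_ifs with h
  · rfl
  · congr 1; omega

lemma cylinder_word (X : Set (ℕ → A)) (x : ℕ → A) (n : ℕ) :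
    cylinder X (word x 0 n) = X ∩ PiNat.cylinder x n := by
  ext z
  simp only [cylinder, length_word, word_zero_eq_iff, Set.mem_ofPred_eq, Set.mem_inter_iff]

lemma IsSubshift.shift_iterate_mem [TopologicalSpace A] {X : Set (ℕ → A)} (hX : IsSubshift X)
    {x : ℕ → A} (hx : x ∈ X) (n : ℕ) : shift^[n] x ∈ X :=
  hX.mapsTo.iterate n hx

lemma mem_language_iff {X : Set (ℕ → A)} {a : List A} :
    a ∈ language X ↔ ∃ x ∈ X, ∃ n, 0 < n ∧ word x 0 n = a := by
  simp only [language, admissible, Set.mem_iUnion, Set.mem_image]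
  constructor
  · rintro ⟨n, x, hx, rfl⟩; exact ⟨x, hx, n + 1, n.succ_pos, rfl⟩
  · rintro ⟨x, hx, n, hn, rfl⟩
    exact ⟨n - 1, x, hx, by rw [Nat.sub_add_cancel hn]⟩

lemma IsSubshift.word_mem_language [TopologicalSpace A] {X : Set (ℕ → A)} (hX : IsSubshift X)
    {x : ℕ → A} (hx : x ∈ X) (i : ℕ) {n : ℕ} (hn : 0 < n) : word x i n ∈ language X := by
  refine mem_language_iff.2 ⟨_, hX.shift_iterate_mem hx i, n, hn, ?_⟩
  rw [word_shift, add_zero]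

/-- A closed set contains each sequence all of whose prefixes are prefixes of its points. -/
lemma mem_of_forall_prefix [TopologicalSpace A] {X : Set (ℕ → A)}
    (hX : IsClosed X) {x : ℕ → A} (h : ∀ n, ∃ y ∈ X, y ∈ PiNat.cylinder x n) : x ∈ X := by
  choose y hy hyx using h
  refine hX.mem_of_tendsto (f := y) (b := atTop) ?_ (Eventually.of_forall hy)
  refine tendsto_pi_nhds.2 fun i => tendsto_nhds_of_eventually_eq ?_
  filter_upwards [eventually_gt_atTop i] with n hn
  exact PiNat.mem_cylinder_iff.1 (hyx n) i hn

/-- A potential is `(C, θ)`-Hölder if it is bounded by `C` and changes by at most `C * θ ^ m`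
between sequences that agree up to the index `m`. -/
structure IsHolderWith (φ : (ℕ → A) → ℝ) (C θ : ℝ) : Prop where
  pos : 0 < θ
  lt_one : θ < 1
  nonneg : 0 ≤ C
  abs_le : ∀ x, |φ x| ≤ C
  abs_sub_le : ∀ (m : ℕ) (x y : ℕ → A), (∀ i ≤ m, x i = y i) → |φ x - φ y| ≤ C * θ ^ m

lemma IsHolder.exists_isHolderWith [Finite A] {φ : (ℕ → A) → ℝ} (h : IsHolder φ) :
    ∃ C θ, IsHolderWith φ C θ := by
  obtain ⟨θ, C, h0, h1, hC, h⟩ := h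
  obtain ⟨M, hM⟩ := (Set.finite_range fun a : A => |φ fun _ => a|).bddAbove
  have hM' : ∀ x, |φ x| ≤ C + |M| := fun x => by
    have h₁ := h 0 x (fun _ => x 0) (fun i hi => by rw [Nat.le_zero.1 hi])
    have h₂ : |φ fun _ => x 0| ≤ M := hM ⟨x 0, rfl⟩
    have h₃ := abs_sub_abs_le_abs_sub (φ x) (φ fun _ => x 0)
    have h₄ := le_abs_self M
    simp only [pow_zero, mul_one] at h₁
    linarith
  refine ⟨C + |M|, max θ (1 / 2), by positivity, by simp [h1]; norm_num, by positivity, hM',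
    fun m x y hxy => (h m x y hxy).trans ?_⟩
  gcongr
  · linarith [abs_nonneg M]
  · exact le_max_left _ _

/-- Birkhoff sums over `n` terms of a Hölder potential vary boundedly, uniformly in `n`, between
sequences with the same first `n` symbols. -/
lemma IsHolderWith.abs_birkhoffSum_sub_le {φ : (ℕ → A) → ℝ} {C θ : ℝ} (h : IsHolderWith φ C θ)
    {n : ℕ} {x y : ℕ → A} (hxy : x ∈ PiNat.cylinder y n) :
    |birkhoffSum shift φ n x - birkhoffSum shift φ n y| ≤ C / (1 - θ) := by
  have key : ∀ (n : ℕ) (x y : ℕ → A), (∀ i < n, x i = y i) →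
      |birkhoffSum shift φ n x - birkhoffSum shift φ n y| ≤ C * ∑ i ∈ Finset.range n, θ ^ i := by
    intro n
    induction n with
    | zero => intro x y _; simp
    | succ n ih =>
      intro x y hxy
      rw [birkhoffSum_succ', birkhoffSum_succ', Finset.sum_range_succ, mul_add]
      have h₁ := h.abs_sub_le n x y fun i hi => hxy i (by omega)
      have h₂ := ih (shift x) (shift y) fun i hi => hxy (i + 1) (by omega)
      have h₃ := abs_add_le (φ x - φ y)
        (birkhoffSum shift φ n (shift x) - birkhoffSum shift φ n (shift y))
      rw [show φ x + birkhoffSum shift φ n (shift x) - (φ y + birkhoffSum shift φ n (shift y)) =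
        φ x - φ y + (birkhoffSum shift φ n (shift x) - birkhoffSum shift φ n (shift y)) by ring]
      linarith
  refine (key n x y (PiNat.mem_cylinder_iff.1 hxy)).trans ?_
  have h1 := sub_pos.2 h.lt_one
  rw [le_div_iff₀ h1, mul_assoc, mul_comm (∑ i ∈ Finset.range n, θ ^ i), mul_neg_geom_sum]
  have := pow_pos h.pos n
  nlinarith [h.nonneg]

lemma IsHolderWith.abs_birkhoffSum_le {φ : (ℕ → A) → ℝ} {C θ : ℝ} (h : IsHolderWith φ C θ)
    (n : ℕ) (x : ℕ → A) : |birkhoffSum shift φ n x| ≤ n * C := by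
  refine (Finset.abs_sum_le_sum_abs _ _).trans ((Finset.sum_le_sum fun i _ => h.abs_le _).trans ?_)
  simp

end SoficGibbs

/-! ### Transfer operators and partition functions -/

namespace SoficGibbs

variable {A : Type*}

/-- The transfer operator with weight `g`: it sums `g * f` over the preimages `a x` of `x` under the
shift. Admissibility of the preimages is encoded by the support of `g`. -/
noncomputable def transfer [Fintype A] (g : (ℕ → A) → ℝ) :
    ((ℕ → A) → ℝ) →ₗ[ℝ] ((ℕ → A) → ℝ) where
  toFun f x := ∑ a, g (cons a x) * f (cons a x)
  map_add' f f' := by funext x; simp [mul_add, Finset.sum_add_distrib]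
  map_smul' c f := by
    funext x
    simp only [Pi.smul_apply, smul_eq_mul, RingHom.id_apply, Finset.mul_sum]
    exact Finset.sum_congr rfl fun a _ => by ring

/-- The product of the weight `g` along the first `n` points of the orbit of `z`. -/
noncomputable def weightProd (g : (ℕ → A) → ℝ) (n : ℕ) (z : ℕ → A) : ℝ :=
  ∏ i ∈ Finset.range n, g (shift^[i] z)

lemma weightProd_nonneg {g : (ℕ → A) → ℝ} (hg : 0 ≤ g) (n : ℕ) (z : ℕ → A) :
    0 ≤ weightProd g n z := Finset.prod_nonneg fun _ _ => hg _

/-- A nonnegative weight that vanishes off `Y`. -/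
structure IsWeightOn (Y : Set (ℕ → A)) (g : (ℕ → A) → ℝ) : Prop where
  nonneg : 0 ≤ g
  eq_zero : ∀ z, z ∉ Y → g z = 0

variable {Y : Set (ℕ → A)} {g : (ℕ → A) → ℝ}

lemma weightProd_eq_zero (hg : IsWeightOn Y g) {n : ℕ} (hn : n ≠ 0) {z : ℕ → A} (hz : z ∉ Y) :
    weightProd g n z = 0 :=
  Finset.prod_eq_zero (Finset.mem_range.2 (Nat.pos_of_ne_zero hn)) (hg.eq_zero _ hz)

/-- The weight `exp φ` restricted to `Y`. -/
noncomputable def expWeight (Y : Set (ℕ → A)) (φ : (ℕ → A) → ℝ) : (ℕ → A) → ℝ :=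
  Y.indicator fun z => Real.exp (φ z)

lemma isWeightOn_expWeight (Y : Set (ℕ → A)) (φ : (ℕ → A) → ℝ) :
    IsWeightOn Y (expWeight Y φ) where
  nonneg := Set.indicator_nonneg fun _ _ => (Real.exp_pos _).le
  eq_zero _ h := Set.indicator_of_notMem h _

lemma weightProd_expWeight (hY : Set.MapsTo shift Y Y) (φ : (ℕ → A) → ℝ) (n : ℕ) {z : ℕ → A}
    (hz : z ∈ Y) : weightProd (expWeight Y φ) n z = Real.exp (birkhoffSum shift φ n z) := by
  rw [birkhoffSum, Real.exp_sum, weightProd]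
  exact Finset.prod_congr rfl fun i _ => Set.indicator_of_mem (hY.iterate i hz) _

/-- For each `y ∈ Y`, any prefix of `y` can be joined to any `x ∈ Y`, inside `Y`, by a word of
length `l`. -/
def IsGluing (Y : Set (ℕ → A)) (l : ℕ) : Prop :=
  ∀ n, ∀ y ∈ Y, ∀ x ∈ Y, ∃ z ∈ Y, z ∈ PiNat.cylinder y n ∧ shift^[n + l] z = x

section
variable [Fintype A]

lemma transfer_apply (g f : (ℕ → A) → ℝ) (x : ℕ → A) :
    transfer g f x = ∑ a, g (cons a x) * f (cons a x) := rfl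

lemma transfer_pow_apply (g f : (ℕ → A) → ℝ) (n : ℕ) (x : ℕ → A) :
    (transfer g ^ n) f x = ∑ w : Fin n → A, weightProd g n (join w x) * f (join w x) := by
  induction n generalizing f with
  | zero => simp [weightProd]
  | succ n ih =>
    rw [pow_succ, Module.End.mul_apply, ih, ← (Fin.consEquiv fun _ => A).sum_comp,
      Fintype.sum_prod_type, Finset.sum_comm]
    refine Finset.sum_congr rfl fun w _ => ?_
    rw [transfer_apply, Finset.mul_sum]
    refine Finset.sum_congr rfl fun a _ => ?_
    simp only [Fin.consEquiv, Equiv.coe_fn_mk, join_cons, weightProd, Finset.prod_range_succ',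
      Function.iterate_succ_apply, shift_cons, Function.iterate_zero, id]
    ring

lemma transfer_pow_succ_apply (g f : (ℕ → A) → ℝ) (n : ℕ) (x : ℕ → A) :
    (transfer g ^ (n + 1)) f x = ∑ a, g (cons a x) * (transfer g ^ n) f (cons a x) := by
  rw [pow_succ', Module.End.mul_apply, transfer_apply]

/-- Observables of the future factor out of the transfer operator. -/
lemma transfer_pow_mul_comp (g f f' : (ℕ → A) → ℝ) (n : ℕ) (x : ℕ → A) :
    (transfer g ^ n) (fun z => f z * f' (shift^[n] z)) x = (transfer g ^ n) f x * f' x := by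
  simp only [transfer_pow_apply, shift_iterate_join, Finset.sum_mul, mul_assoc]

lemma IsWeightOn.transfer_pow_mono (hg : IsWeightOn Y g) {f f' : (ℕ → A) → ℝ}
    (h : ∀ x ∈ Y, f x ≤ f' x) (n : ℕ) : ∀ x ∈ Y, (transfer g ^ n) f x ≤ (transfer g ^ n) f' x := by
  induction n with
  | zero => simpa using h
  | succ n ih =>
    intro x _
    rw [transfer_pow_succ_apply, transfer_pow_succ_apply]
    refine Finset.sum_le_sum fun a _ => ?_
    by_cases ha : cons a x ∈ Y
    · exact mul_le_mul_of_nonneg_left (ih _ ha) (hg.nonneg _)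
    · simp [hg.eq_zero _ ha]

lemma IsWeightOn.transfer_pow_congr (hg : IsWeightOn Y g) {f f' : (ℕ → A) → ℝ}
    (h : ∀ x ∈ Y, f x = f' x) (n : ℕ) {x : ℕ → A} (hx : x ∈ Y) :
    (transfer g ^ n) f x = (transfer g ^ n) f' x :=
  le_antisymm (hg.transfer_pow_mono (fun x hx => (h x hx).le) n x hx)
    (hg.transfer_pow_mono (fun x hx => (h x hx).ge) n x hx)

lemma IsWeightOn.transfer_pow_nonneg (hg : IsWeightOn Y g) {f : (ℕ → A) → ℝ}
    (h : ∀ x ∈ Y, 0 ≤ f x) (n : ℕ) {x : ℕ → A} (hx : x ∈ Y) : 0 ≤ (transfer g ^ n) f x := by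
  simpa using hg.transfer_pow_mono (f := 0) (fun x hx => h x hx) n x hx

/-- A single branch bounds the transfer operator from below. -/
lemma IsWeightOn.weightProd_mul_le (hg : IsWeightOn Y g) (hY : Set.MapsTo shift Y Y)
    {f : (ℕ → A) → ℝ} (h : ∀ x ∈ Y, 0 ≤ f x) (n : ℕ) {z : ℕ → A} (hz : z ∈ Y) :
    weightProd g n z * f z ≤ (transfer g ^ n) f (shift^[n] z) := by
  induction n generalizing f z with
  | zero => simp [weightProd]
  | succ n ih =>
    have h₀ : ∀ x ∈ Y, 0 ≤ transfer g f x := fun x hx => by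
      simpa using hg.transfer_pow_nonneg h 1 hx
    have h₁ : g z * f z ≤ transfer g f (shift z) := by
      have h₂ := Finset.single_le_sum (f := fun a => g (cons a (shift z)) * f (cons a (shift z)))
        (s := Finset.univ) (fun a _ => ?_) (Finset.mem_univ (z 0))
      · simpa only [cons_shift, transfer_apply] using h₂
      · by_cases ha : cons a (shift z) ∈ Y
        · exact mul_nonneg (hg.nonneg _) (h _ ha)
        · simp [hg.eq_zero _ ha]
    have h₃ : weightProd g (n + 1) z = weightProd g n (shift z) * g z := by
      simp only [weightProd, Finset.prod_range_succ', Function.iterate_succ_apply,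
        Function.iterate_zero, id]
    rw [pow_succ, Module.End.mul_apply, Function.iterate_succ_apply, h₃, mul_assoc]
    exact (mul_le_mul_of_nonneg_left h₁ (weightProd_nonneg hg.nonneg _ _)).trans (ih h₀ (hY hz))

/-- The partition function over the preimages in `Y` of `x` under the `n`-th iterate of the
shift. -/
noncomputable def partition (Y : Set (ℕ → A)) (φ : (ℕ → A) → ℝ) (n : ℕ) (x : ℕ → A) : ℝ :=
  (transfer (expWeight Y φ) ^ n) 1 x

lemma partition_le {φ : (ℕ → A) → ℝ} {C θ : ℝ} (hφ : IsHolderWith φ C θ)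
    (n : ℕ) : ∀ x ∈ Y, partition Y φ n x ≤ (Fintype.card A * Real.exp C) ^ n := by
  induction n with
  | zero => simp [partition]
  | succ n ih =>
    intro x _
    rw [partition, transfer_pow_succ_apply, pow_succ', mul_assoc, ← nsmul_eq_mul, Fintype.card,
      ← Finset.sum_const]
    refine Finset.sum_le_sum fun a _ => ?_
    by_cases ha : cons a x ∈ Y
    · refine mul_le_mul ?_ (ih _ ha)
        ((isWeightOn_expWeight Y φ).transfer_pow_nonneg (by simp) _ ha) (Real.exp_pos _).le
      rw [expWeight, Set.indicator_of_mem ha]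
      exact Real.exp_le_exp.2 ((le_abs_self _).trans (hφ.abs_le _))
    · rw [(isWeightOn_expWeight Y φ).eq_zero _ ha, zero_mul]
      positivity

lemma partition_nonneg (φ : (ℕ → A) → ℝ) (n : ℕ) {x : ℕ → A} (hx : x ∈ Y) :
    0 ≤ partition Y φ n x :=
  (isWeightOn_expWeight Y φ).transfer_pow_nonneg (by simp) _ hx

lemma partition_add_le {φ : (ℕ → A) → ℝ} {C θ : ℝ} (hφ : IsHolderWith φ C θ) (n l : ℕ)
    {x : ℕ → A} (hx : x ∈ Y) :
    partition Y φ (n + l) x ≤ (Fintype.card A * Real.exp C) ^ l * partition Y φ n x := by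
  rw [partition, pow_add, Module.End.mul_apply]
  have h := (isWeightOn_expWeight Y φ).transfer_pow_mono
    (f := (transfer (expWeight Y φ) ^ l) 1)
    (f' := ((Fintype.card A * Real.exp C) ^ l : ℝ) • (1 : (ℕ → A) → ℝ))
    (fun x hx => by simpa [partition] using partition_le hφ l x hx) n x hx
  rwa [map_smul] at h

/-- Gluing injects the preimages of `y` into those of `x`, at bounded cost. -/
lemma partition_le_partition_add {φ : (ℕ → A) → ℝ} {C θ : ℝ} (hφ : IsHolderWith φ C θ)
    (hY : Set.MapsTo shift Y Y) {l : ℕ} (hl : IsGluing Y l) (n : ℕ)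
    {x y : ℕ → A} (hx : x ∈ Y) (hy : y ∈ Y) :
    partition Y φ n y ≤ Real.exp (C / (1 - θ) + l * C) * partition Y φ (n + l) x := by
  classical
  have hw := isWeightOn_expWeight Y φ
  rcases Nat.eq_zero_or_pos n with rfl | hn
  · obtain ⟨z, hz, -, hzx⟩ := hl 0 y hy x hx
    rw [zero_add] at hzx ⊢
    have h := hw.weightProd_mul_le hY (f := 1) (by simp) l hz
    rw [weightProd_expWeight hY φ _ hz, hzx, Pi.one_apply, mul_one] at h
    have h₁ := neg_le_of_abs_le (hφ.abs_birkhoffSum_le l z)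
    have h₂ : 0 ≤ C / (1 - θ) := div_nonneg hφ.nonneg (sub_pos.2 hφ.lt_one).le
    calc partition Y φ 0 y = 1 := by simp [partition]
      _ ≤ Real.exp (C / (1 - θ) + l * C) * Real.exp (birkhoffSum shift φ l z) := by
        rw [← Real.exp_add]; exact Real.one_le_exp (by linarith)
      _ ≤ _ := by gcongr; exact h
  have : Nonempty (ℕ → A) := ⟨x⟩
  choose! z hzY hzc hzx using fun (w : Fin n → A) (hw : join w y ∈ Y) => hl n (join w y) hw x hx
  let e : (Fin n → A) → (Fin (n + l) → A) := fun w i => z w i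
  let s : Finset (Fin n → A) := Finset.univ.filter fun w => join w y ∈ Y
  have hez : ∀ w ∈ s, join (e w) x = z w := fun w hws => by
    rw [← hzx w (Finset.mem_filter.1 hws).2]; exact join_prefix _ _
  have hinj : Set.InjOn e s := fun w hws w' hws' h => by
    funext i
    have h₁ := PiNat.mem_cylinder_iff.1 (hzc w (Finset.mem_filter.1 hws).2) i i.2
    have h₂ := PiNat.mem_cylinder_iff.1 (hzc w' (Finset.mem_filter.1 hws').2) i i.2
    have h₃ : z w i = z w' i := congrFun h (Fin.castAdd l i)
    rw [join_of_lt _ _ i.2] at h₁ h₂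
    rw [h₁, h₂] at h₃
    exact h₃
  have h₁ : partition Y φ n y = ∑ w ∈ s, Real.exp (birkhoffSum shift φ n (join w y)) := by
    rw [partition, transfer_pow_apply, Finset.sum_filter]
    refine Finset.sum_congr rfl fun w _ => ?_
    split_ifs with h
    · rw [weightProd_expWeight hY φ _ h, Pi.one_apply, mul_one]
    · rw [weightProd_eq_zero hw hn.ne' h, zero_mul]
  have h₂ : ∑ v ∈ s.image e, Real.exp (birkhoffSum shift φ (n + l) (join v x)) ≤
      partition Y φ (n + l) x := by
    rw [partition, transfer_pow_apply]
    refine (Finset.sum_le_sum fun v hv => ?_).trans (Finset.sum_le_univ_sum_of_nonneg fun v => ?_)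
    · obtain ⟨w, hws, rfl⟩ := Finset.mem_image.1 hv
      rw [hez w hws, weightProd_expWeight hY φ _ (hzY w (Finset.mem_filter.1 hws).2),
        Pi.one_apply, mul_one]
    · exact mul_nonneg (weightProd_nonneg hw.nonneg _ _) zero_le_one
  rw [Finset.sum_image hinj] at h₂
  refine le_trans ?_ (mul_le_mul_of_nonneg_left h₂ (Real.exp_pos _).le)
  rw [h₁, Finset.mul_sum]
  refine Finset.sum_le_sum fun w hws => ?_
  have hwY := (Finset.mem_filter.1 hws).2
  rw [hez w hws, ← Real.exp_add, birkhoffSum_add]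
  refine Real.exp_le_exp.2 ?_
  have h₃ := neg_le_of_abs_le (hφ.abs_birkhoffSum_sub_le (hzc w hwY))
  have h₄ := neg_le_of_abs_le (hφ.abs_birkhoffSum_le l (shift^[n] (z w)))
  linarith

/-- The constant by which partition functions at different points are comparable. -/
noncomputable def partitionConst (A : Type*) [Fintype A] (C θ : ℝ) (l : ℕ) : ℝ :=
  Real.exp (C / (1 - θ) + l * C) * (Fintype.card A * Real.exp C) ^ l

lemma partition_le_mul {φ : (ℕ → A) → ℝ} {C θ : ℝ} (hφ : IsHolderWith φ C θ)
    (hY : Set.MapsTo shift Y Y) {l : ℕ} (hl : IsGluing Y l) (n : ℕ)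
    {x y : ℕ → A} (hx : x ∈ Y) (hy : y ∈ Y) :
    partition Y φ n y ≤ partitionConst A C θ l * partition Y φ n x := by
  refine (partition_le_partition_add hφ hY hl n hx hy).trans ?_
  rw [partitionConst, mul_assoc]
  exact mul_le_mul_of_nonneg_left (partition_add_le hφ n l hx) (Real.exp_pos _).le

lemma exp_neg_le_partition {φ : (ℕ → A) → ℝ} {C θ : ℝ} (hφ : IsHolderWith φ C θ)
    (hY : Set.MapsTo shift Y Y) {l : ℕ} (hl : IsGluing Y l) (n : ℕ)
    {x : ℕ → A} (hx : x ∈ Y) : Real.exp (-(n * C)) ≤ partition Y φ n x := by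
  obtain ⟨z', hz', hzx⟩ : ∃ z' ∈ Y, shift^[n] z' = x := by
    obtain ⟨z, hz, -, hzx⟩ := hl n x hx x hx
    exact ⟨shift^[l] z, hY.iterate l hz, by rw [← Function.iterate_add_apply, hzx]⟩
  have h := (isWeightOn_expWeight Y φ).weightProd_mul_le hY (f := 1) (by simp) n hz'
  rw [weightProd_expWeight hY φ _ hz', hzx, Pi.one_apply, mul_one] at h
  exact (Real.exp_le_exp.2 (neg_le_of_abs_le (hφ.abs_birkhoffSum_le n z'))).trans h

end
end SoficGibbs

/-! ### Banach limits and almost additive sequences -/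

namespace SoficGibbs

/-- A linear functional on real sequences that is a Banach limit on the bounded ones: positive,
normalised and invariant under translation. Its values on unbounded sequences have no meaning. -/
structure IsBanachLimit (B : (ℕ → ℝ) →ₗ[ℝ] ℝ) : Prop where
  nonneg : ∀ u : ℕ → ℝ, (∀ n, 0 ≤ u n) → (∃ M, ∀ n, u n ≤ M) → 0 ≤ B u
  one : B 1 = 1
  comp_succ : ∀ u : ℕ → ℝ, (∃ M, ∀ n, |u n| ≤ M) → B (fun n => u (n + 1)) = B u

lemma exists_tendsto_of_abs_le (𝒰 : Ultrafilter ℕ) {f : ℕ → ℝ} {M : ℝ} (h : ∀ n, |f n| ≤ M) :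
    ∃ a, Tendsto f 𝒰 (𝓝 a) := by
  obtain ⟨a, -, ha⟩ := (isCompact_Icc (a := -M) (b := M)).ultrafilter_le_nhds' (𝒰.map f)
    (Ultrafilter.mem_map.2 (univ_mem' fun n => abs_le.1 (h n)))
  exact ⟨a, ha⟩

/-- Banach limits exist: take an ultrafilter limit of the Cesàro means. -/
lemma exists_isBanachLimit : ∃ B : (ℕ → ℝ) →ₗ[ℝ] ℝ, IsBanachLimit B := by
  let avg : (ℕ → ℝ) → ℕ → ℝ := fun u N => (N + 1 : ℝ)⁻¹ * ∑ n ∈ Finset.range (N + 1), u n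
  have havg : ∀ {u : ℕ → ℝ} {M : ℝ}, (∀ n, |u n| ≤ M) → ∀ N, |avg u N| ≤ M := fun {u M} h N => by
    have h₁ : |∑ n ∈ Finset.range (N + 1), u n| ≤ (N + 1) * M :=
      (Finset.abs_sum_le_sum_abs _ _).trans ((Finset.sum_le_sum fun i _ => h i).trans (by simp))
    have h₂ : (0 : ℝ) < N + 1 := by positivity
    rw [abs_mul, abs_of_pos (inv_pos.2 h₂), inv_mul_le_iff₀ h₂]
    exact h₁
  let 𝒰 : Ultrafilter ℕ := hyperfilter ℕ
  let S : Submodule ℝ (ℕ → ℝ) :=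
    { carrier := {u | ∃ M, ∀ n, |u n| ≤ M}
      add_mem' := by
        rintro u v ⟨M, hM⟩ ⟨M', hM'⟩
        exact ⟨M + M', fun n => (abs_add_le _ _).trans (add_le_add (hM n) (hM' n))⟩
      zero_mem' := ⟨0, by simp⟩
      smul_mem' := by
        rintro c u ⟨M, hM⟩
        refine ⟨|c| * M, fun n => ?_⟩
        rw [Pi.smul_apply, smul_eq_mul, abs_mul]
        exact mul_le_mul_of_nonneg_left (hM n) (abs_nonneg c) }
  have hlim : ∀ u : S, ∃ a, Tendsto (avg u) 𝒰 (𝓝 a) := by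
    rintro ⟨u, M, hM⟩
    exact exists_tendsto_of_abs_le 𝒰 (havg hM)
  choose b hb using hlim
  let b' : S →ₗ[ℝ] ℝ :=
    { toFun := b
      map_add' := fun u v => by
        refine tendsto_nhds_unique (hb (u + v)) (((hb u).add (hb v)).congr fun N => ?_)
        simp [avg, Finset.sum_add_distrib, mul_add]
      map_smul' := fun c u => by
        refine tendsto_nhds_unique (hb (c • u)) (((hb u).const_mul c).congr fun N => ?_)
        simp only [avg, Submodule.coe_smul, Pi.smul_apply, smul_eq_mul, ← Finset.mul_sum]
        ring }
  obtain ⟨B, hB⟩ := b'.exists_extend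
  have hBu : ∀ (u : ℕ → ℝ) (hu : ∃ M, ∀ n, |u n| ≤ M), Tendsto (avg u) 𝒰 (𝓝 (B u)) :=
    fun u hu => by
      have h := LinearMap.congr_fun hB (⟨u, hu⟩ : S)
      rw [LinearMap.comp_apply] at h
      exact h ▸ hb ⟨u, hu⟩
  refine ⟨B, ?_, ?_, ?_⟩
  · rintro u h0 ⟨M, hM⟩
    refine ge_of_tendsto' (hBu u ⟨M, fun n => by rw [abs_of_nonneg (h0 n)]; exact hM n⟩) fun N => ?_
    exact mul_nonneg (by positivity) (Finset.sum_nonneg fun n _ => h0 n)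
  · refine tendsto_nhds_unique (hBu 1 ⟨1, by simp⟩) (tendsto_const_nhds.congr fun N => ?_)
    have : (N + 1 : ℝ) ≠ 0 := by positivity
    simp [avg, this]
  · rintro u ⟨M, hM⟩
    have h₁ := (hBu _ ⟨M, fun n => hM (n + 1)⟩).sub (hBu u ⟨M, hM⟩)
    -- the Cesàro means of `u` and of its translate differ by a boundary term
    have h₂ : Tendsto (fun N => avg (fun n => u (n + 1)) N - avg u N) 𝒰 (𝓝 0) := by
      have h₃ : Tendsto (fun N : ℕ => (2 * M) * (1 / ((N : ℝ) + 1))) 𝒰 (𝓝 0) := by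
        have := (tendsto_one_div_add_atTop_nhds_zero_nat (𝕜 := ℝ)).const_mul (2 * M)
        rw [mul_zero] at this
        exact this.mono_left Nat.hyperfilter_le_atTop
      refine squeeze_zero_norm (fun N => ?_) h₃
      have h₄ : avg (fun n => u (n + 1)) N - avg u N = (N + 1 : ℝ)⁻¹ * (u (N + 1) - u 0) := by
        simp only [avg]
        rw [← mul_sub, ← Finset.sum_sub_distrib, Finset.sum_range_sub]
      have h₅ : (0 : ℝ) < (N + 1 : ℝ)⁻¹ := by positivity
      rw [h₄, Real.norm_eq_abs, abs_mul, abs_of_pos h₅, one_div, mul_comm]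
      refine mul_le_mul_of_nonneg_right ((abs_sub _ _).trans ?_) h₅.le
      linarith [hM (N + 1), hM 0]
    exact sub_eq_zero.1 (tendsto_nhds_unique h₁ h₂)

namespace IsBanachLimit

variable {B : (ℕ → ℝ) →ₗ[ℝ] ℝ}

lemma const (hB : IsBanachLimit B) (c : ℝ) : B (fun _ => c) = c := by
  have h : (fun _ : ℕ => c) = c • (1 : ℕ → ℝ) := by funext; simp
  rw [h, map_smul, hB.one, smul_eq_mul, mul_one]

lemma mono (hB : IsBanachLimit B) {u v : ℕ → ℝ} (h : ∀ n, u n ≤ v n)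
    (hu : ∃ M, ∀ n, |u n| ≤ M) (hv : ∃ M, ∀ n, |v n| ≤ M) : B u ≤ B v := by
  obtain ⟨M, hM⟩ := hu
  obtain ⟨M', hM'⟩ := hv
  have := hB.nonneg (v - u) (fun n => sub_nonneg.2 (h n))
    ⟨M' + M, fun n => by
      have := neg_le_of_abs_le (hM n)
      have := le_of_abs_le (hM' n)
      simp only [Pi.sub_apply]; linarith⟩
  rw [map_sub] at this
  linarith

lemma comp_add (hB : IsBanachLimit B) {u : ℕ → ℝ} (hu : ∃ M, ∀ n, |u n| ≤ M) (k : ℕ) :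
    B (fun n => u (n + k)) = B u := by
  induction k with
  | zero => rfl
  | succ k ih =>
    obtain ⟨M, hM⟩ := hu
    rw [← ih, ← hB.comp_succ (fun n => u (n + k)) ⟨M, fun n => hM _⟩]
    congr 1
    funext n
    congr 1
    ring

end IsBanachLimit

/-- A sequence that is additive up to a bounded error is linear up to the same error. -/
lemma exists_abs_sub_mul_le {u : ℕ → ℝ} {c R : ℝ} (h : ∀ m n, |u (m + n) - u m - u n| ≤ c)
    (hR : ∀ n, |u n| ≤ n * R) : ∃ P, ∀ n : ℕ, |u n - n * P| ≤ c := by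
  have hc : 0 ≤ c := (abs_nonneg _).trans (h 0 0)
  have h₁ : Subadditive fun n => u n + c := fun m n => by
    have := le_of_abs_le (h m n); linarith
  have h₂ : Subadditive fun n => -u n + c := fun m n => by
    have := neg_le_of_abs_le (h m n); linarith
  have hdiv : ∀ n : ℕ, |u n / n| ≤ |R| := fun n => by
    rcases Nat.eq_zero_or_pos n with rfl | hn
    · simp
    · have hn' : (0 : ℝ) < n := by exact_mod_cast hn
      rw [abs_div, abs_of_pos hn', div_le_iff₀ hn', mul_comm]
      exact (hR n).trans (by gcongr; exact le_abs_self R)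
  have hb₁ : BddBelow (Set.range fun n : ℕ => (u n + c) / n) := by
    refine ⟨-|R|, ?_⟩
    rintro _ ⟨n, rfl⟩
    have h₃ := neg_le_of_abs_le (hdiv n)
    have h₄ : 0 ≤ c / n := by positivity
    simp only [add_div]; linarith
  have hb₂ : BddBelow (Set.range fun n : ℕ => (-u n + c) / n) := by
    refine ⟨-|R|, ?_⟩
    rintro _ ⟨n, rfl⟩
    have h₃ := le_of_abs_le (hdiv n)
    have h₄ : 0 ≤ c / n := by positivity
    simp only [add_div, neg_div]; linarith
  have hlim : h₁.lim = -h₂.lim := by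
    have h₃ := (h₁.tendsto_lim hb₁).add (h₂.tendsto_lim hb₂)
    have h₄ : Tendsto (fun n : ℕ => 2 * c / (n : ℝ)) atTop (𝓝 0) :=
      tendsto_const_div_atTop_nhds_zero_nat _
    have h₅ := tendsto_nhds_unique h₃ (h₄.congr fun n => by ring)
    linarith
  refine ⟨h₁.lim, fun n => ?_⟩
  rcases Nat.eq_zero_or_pos n with rfl | hn
  · have h0 : u 0 = 0 := by simpa using hR 0
    simpa [h0] using hc
  · have hn' : (0 : ℝ) < n := by exact_mod_cast hn
    have h₃ := h₁.lim_le_div hb₁ hn.ne'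
    have h₄ := h₂.lim_le_div hb₂ hn.ne'
    rw [le_div_iff₀ hn'] at h₃ h₄
    rw [abs_le]
    constructor
    · linarith
    · rw [hlim]; linarith

end SoficGibbs

/-! ### Pressure and eigenfunctions -/

namespace SoficGibbs

variable {A : Type*} [Fintype A] {Y : Set (ℕ → A)} {φ : (ℕ → A) → ℝ} {C θ : ℝ} {l : ℕ}

lemma partition_add (Y : Set (ℕ → A)) (φ : (ℕ → A) → ℝ) (m n : ℕ) :
    partition Y φ (m + n) = (transfer (expWeight Y φ) ^ m) (partition Y φ n) := by
  funext x
  rw [partition, pow_add, Module.End.mul_apply]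
  rfl

lemma partition_pos (hφ : IsHolderWith φ C θ) (hY : Set.MapsTo shift Y Y) (hl : IsGluing Y l)
    (n : ℕ) {x : ℕ → A} (hx : x ∈ Y) : 0 < partition Y φ n x :=
  (Real.exp_pos _).trans_le (exp_neg_le_partition hφ hY hl n hx)

lemma one_le_partitionConst (hφ : IsHolderWith φ C θ) (hY : Set.MapsTo shift Y Y)
    (hl : IsGluing Y l) (hne : Y.Nonempty) : 1 ≤ partitionConst A C θ l := by
  obtain ⟨x, hx⟩ := hne
  have h := partition_le_mul hφ hY hl 0 hx hx
  simpa [partition] using h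

/-- A bound for the absolute value of the pressure. -/
noncomputable def pressureConst (A : Type*) [Fintype A] (C θ : ℝ) (l : ℕ) : ℝ :=
  C + Real.log (Fintype.card A) + Real.log (partitionConst A C θ l)

/-- The partition functions grow like `exp (n * P)`, where `P` is the pressure, with constants that
depend only on the Hölder data of the potential, the gap and the alphabet. -/
lemma exists_pressure (hφ : IsHolderWith φ C θ) (hY : Set.MapsTo shift Y Y) (hl : IsGluing Y l)
    (hne : Y.Nonempty) : ∃ P, |P| ≤ pressureConst A C θ l ∧ ∀ n : ℕ, ∀ x ∈ Y,
      (partitionConst A C θ l ^ 2)⁻¹ ≤ Real.exp (-(n * P)) * partition Y φ n x ∧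
      Real.exp (-(n * P)) * partition Y φ n x ≤ partitionConst A C θ l ^ 2 := by
  have hK := one_le_partitionConst hφ hY hl hne
  set K := partitionConst A C θ l
  obtain ⟨x₀, hx₀⟩ := hne
  have hK0 : 0 < K := one_pos.trans_le hK
  have hpos : ∀ n, ∀ x ∈ Y, 0 < partition Y φ n x := fun n x hx => partition_pos hφ hY hl n hx
  have hcmp : ∀ n, ∀ x ∈ Y, ∀ y ∈ Y, partition Y φ n y ≤ K * partition Y φ n x :=
    fun n x hx y hy => partition_le_mul hφ hY hl n hx hy
  have hw := isWeightOn_expWeight Y φ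
  let u : ℕ → ℝ := fun n => Real.log (partition Y φ n x₀)
  have hupper : ∀ m n, partition Y φ (m + n) x₀ ≤
      K * (partition Y φ m x₀ * partition Y φ n x₀) := fun m n => by
    have h := hw.transfer_pow_mono (f := partition Y φ n)
      (f' := (K * partition Y φ n x₀) • (1 : (ℕ → A) → ℝ))
      (fun x hx => by simpa using hcmp n x₀ hx₀ x hx) m x₀ hx₀
    rw [map_smul, ← partition_add] at h
    refine h.trans_eq ?_
    rw [Pi.smul_apply, smul_eq_mul, ← partition]
    ring
  have hlower : ∀ m n, partition Y φ m x₀ * partition Y φ n x₀ ≤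
      K * partition Y φ (m + n) x₀ := fun m n => by
    have h := hw.transfer_pow_mono (f := partition Y φ n x₀ • (1 : (ℕ → A) → ℝ))
      (f' := K • partition Y φ n)
      (fun x hx => by simpa using hcmp n x hx x₀ hx₀) m x₀ hx₀
    rw [map_smul, map_smul, ← partition_add, Pi.smul_apply, Pi.smul_apply, smul_eq_mul,
      smul_eq_mul, ← partition] at h
    linarith
  have hadd : ∀ m n, |u (m + n) - u m - u n| ≤ Real.log K := fun m n => by
    have h₁ := Real.log_le_log (hpos _ _ hx₀) (hupper m n)
    have h₂ := Real.log_le_log (mul_pos (hpos m _ hx₀) (hpos n _ hx₀)) (hlower m n)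
    rw [Real.log_mul hK0.ne' (mul_pos (hpos m _ hx₀) (hpos n _ hx₀)).ne',
      Real.log_mul (hpos m _ hx₀).ne' (hpos n _ hx₀).ne'] at h₁
    rw [Real.log_mul hK0.ne' (hpos _ _ hx₀).ne',
      Real.log_mul (hpos m _ hx₀).ne' (hpos n _ hx₀).ne'] at h₂
    rw [abs_le]
    constructor <;> simp only [u] <;> linarith
  have hcard : (0 : ℝ) < Fintype.card A := by
    have : Nonempty A := ⟨x₀ 0⟩
    exact_mod_cast Fintype.card_pos
  have hcard1 : 0 ≤ Real.log (Fintype.card A) := Real.log_natCast_nonneg _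
  have hlin : ∀ n, |u n| ≤ n * (C + Real.log (Fintype.card A)) := fun n => by
    have h₁ := Real.log_le_log (hpos n _ hx₀) (partition_le hφ n x₀ hx₀)
    have h₂ := Real.log_le_log (Real.exp_pos _) (exp_neg_le_partition hφ hY hl n hx₀)
    rw [Real.log_pow, Real.log_mul hcard.ne' (Real.exp_pos _).ne', Real.log_exp] at h₁
    rw [Real.log_exp] at h₂
    have h₃ : (0 : ℝ) ≤ n * Real.log (Fintype.card A) := by positivity
    rw [abs_le]
    constructor <;> simp only [u] <;> linarith
  obtain ⟨P, hP⟩ := exists_abs_sub_mul_le hadd hlin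
  refine ⟨P, ?_, fun n x hx => ?_⟩
  · have h₁ := hP 1
    have h₂ := hlin 1
    rw [Nat.cast_one, one_mul] at h₁ h₂
    have h₃ := abs_sub_abs_le_abs_sub P (u 1)
    rw [abs_sub_comm] at h₃
    rw [pressureConst]
    linarith
  · have h₁ := abs_le.1 (hP n)
    have hE : Real.exp (-(n * P)) * partition Y φ n x₀ = Real.exp (u n - n * P) := by
      rw [sub_eq_add_neg, Real.exp_add, Real.exp_log (hpos n _ hx₀), mul_comm]
    have h₂ : Real.exp (-(n * P)) * partition Y φ n x₀ ≤ K := by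
      rw [hE]; exact (Real.exp_le_exp.2 h₁.2).trans_eq (Real.exp_log hK0)
    have h₃ : K⁻¹ ≤ Real.exp (-(n * P)) * partition Y φ n x₀ := by
      rw [hE, ← Real.exp_log hK0, ← Real.exp_neg]; exact Real.exp_le_exp.2 h₁.1
    have h₄ := mul_le_mul_of_nonneg_left (hcmp n x₀ hx₀ x hx) (Real.exp_pos (-(n * P))).le
    have h₅ := mul_le_mul_of_nonneg_left (hcmp n x hx x₀ hx₀) (Real.exp_pos (-(n * P))).le
    constructor
    · rw [inv_le_iff_one_le_mul₀ (by positivity)]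
      rw [inv_le_iff_one_le_mul₀ hK0] at h₃
      nlinarith
    · nlinarith

/-- `h` is an eigenfunction, for the eigenvalue `exp P`, of the transfer operator of `φ` on `Y`,
with values between `K⁻¹` and `K` on `Y`. -/
structure IsEigenfunction (Y : Set (ℕ → A)) (φ : (ℕ → A) → ℝ) (P K : ℝ) (h : (ℕ → A) → ℝ) :
    Prop where
  one_le : 1 ≤ K
  inv_le : ∀ x ∈ Y, K⁻¹ ≤ h x
  le : ∀ x ∈ Y, h x ≤ K
  transfer_eq : ∀ x ∈ Y, transfer (expWeight Y φ) h x = Real.exp P * h x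

/-- The Banach limit of the normalised partition functions is an eigenfunction. It inherits every
bound on ratios of partition functions. -/
lemma exists_isEigenfunction (hφ : IsHolderWith φ C θ) (hY : Set.MapsTo shift Y Y)
    (hl : IsGluing Y l) (hne : Y.Nonempty) : ∃ P h, |P| ≤ pressureConst A C θ l ∧
      IsEigenfunction Y φ P (partitionConst A C θ l ^ 2) h ∧
      ∀ x ∈ Y, ∀ y ∈ Y, ∀ t, (∀ n, partition Y φ n x ≤ t * partition Y φ n y) → h x ≤ t * h y := by
  classical
  have hK := one_le_partitionConst hφ hY hl hne
  obtain ⟨P, hPR, hP⟩ := exists_pressure hφ hY hl hne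
  set K := partitionConst A C θ l
  have hK0 : 0 < K := one_pos.trans_le hK
  obtain ⟨B, hB⟩ := exists_isBanachLimit
  let u : (ℕ → A) → ℕ → ℝ := fun x n => Real.exp (-(n * P)) * partition Y φ n x
  have hu : ∀ x ∈ Y, ∀ n, |u x n| ≤ K ^ 2 := fun x hx n => by
    rw [abs_of_nonneg (mul_nonneg (Real.exp_pos _).le (partition_nonneg φ n hx))]
    exact (hP n x hx).2
  refine ⟨P, fun x => B (u x), hPR, ⟨one_le_pow₀ hK, fun x hx => ?_, fun x hx => ?_,
    fun x hx => ?_⟩, fun x hx y hy t h => ?_⟩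
  · rw [← hB.const (K ^ 2)⁻¹]
    exact hB.mono (fun n => (hP n x hx).1) ⟨_, fun _ => le_rfl⟩ ⟨_, hu x hx⟩
  · rw [← hB.const (K ^ 2)]
    exact hB.mono (fun n => (hP n x hx).2) ⟨_, hu x hx⟩ ⟨_, fun _ => le_rfl⟩
  · rw [transfer_apply]
    simp only [← smul_eq_mul (a := expWeight Y φ _), ← map_smul]
    rw [← map_sum, ← smul_eq_mul, ← hB.comp_succ (u x) ⟨_, hu x hx⟩, ← map_smul]
    congr 1
    funext n
    simp only [Finset.sum_apply, Pi.smul_apply, smul_eq_mul, u, partition]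
    rw [transfer_pow_succ_apply, ← mul_assoc, ← Real.exp_add, Finset.mul_sum]
    refine Finset.sum_congr rfl fun a _ => ?_
    rw [show P + -(((n + 1 : ℕ) : ℝ) * P) = -(n * P) by push_cast; ring]
    ring
  · rw [← smul_eq_mul, ← map_smul]
    refine hB.mono (fun n => ?_) ⟨_, hu x hx⟩ ⟨|t| * K ^ 2, fun n => ?_⟩
    · rw [Pi.smul_apply, smul_eq_mul]
      simp only [u]
      calc _ ≤ Real.exp (-(n * P)) * (t * partition Y φ n y) := by gcongr; exact h n
        _ = _ := by ring
    · rw [Pi.smul_apply, smul_eq_mul, abs_mul]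
      gcongr
      exact hu y hy n

/-- The weight of the transfer operator normalised by the eigenfunction `h`. -/
noncomputable def normWeight (Y : Set (ℕ → A)) (φ : (ℕ → A) → ℝ) (P : ℝ) (h : (ℕ → A) → ℝ) :
    (ℕ → A) → ℝ :=
  Y.indicator fun z => Real.exp (φ z - P) * h z / h (shift z)

variable {P K : ℝ} {h : (ℕ → A) → ℝ}

lemma IsEigenfunction.pos (hh : IsEigenfunction Y φ P K h) {x : ℕ → A} (hx : x ∈ Y) : 0 < h x :=
  (inv_pos.2 (one_pos.trans_le hh.one_le)).trans_le (hh.inv_le x hx)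

lemma IsEigenfunction.isWeightOn (hh : IsEigenfunction Y φ P K h) (hY : Set.MapsTo shift Y Y) :
    IsWeightOn Y (normWeight Y φ P h) where
  nonneg := Set.indicator_nonneg fun _ hz =>
    div_nonneg (mul_nonneg (Real.exp_pos _).le (hh.pos hz).le) (hh.pos (hY hz)).le
  eq_zero _ h := Set.indicator_of_notMem h _

lemma IsEigenfunction.transfer_one (hh : IsEigenfunction Y φ P K h) {x : ℕ → A} (hx : x ∈ Y) :
    transfer (normWeight Y φ P h) 1 x = 1 := by
  have h₁ := hh.transfer_eq x hx
  have h₂ := (hh.pos hx).ne'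
  rw [transfer_apply] at h₁ ⊢
  have h₃ : ∀ a, normWeight Y φ P h (cons a x) * (1 : (ℕ → A) → ℝ) (cons a x) =
      expWeight Y φ (cons a x) * h (cons a x) * (Real.exp (-P) / h x) := fun a => by
    by_cases ha : cons a x ∈ Y
    · rw [normWeight, expWeight, Set.indicator_of_mem ha, Set.indicator_of_mem ha, shift_cons,
        sub_eq_add_neg, Real.exp_add, Pi.one_apply]
      ring
    · simp [normWeight, expWeight, Set.indicator_of_notMem ha]
  rw [Finset.sum_congr rfl fun a _ => h₃ a, ← Finset.sum_mul, h₁, mul_comm (Real.exp P), mul_assoc,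
    ← mul_div_assoc, ← Real.exp_add, add_neg_cancel, Real.exp_zero, mul_one_div, div_self h₂]

lemma IsEigenfunction.transfer_pow_const (hh : IsEigenfunction Y φ P K h)
    (hY : Set.MapsTo shift Y Y) (c : ℝ) (n : ℕ) {x : ℕ → A} (hx : x ∈ Y) :
    (transfer (normWeight Y φ P h) ^ n) (fun _ => c) x = c := by
  have hc : (fun _ : ℕ → A => c) = c • (1 : (ℕ → A) → ℝ) := by funext; simp
  have h1 : ∀ n, ∀ x ∈ Y, (transfer (normWeight Y φ P h) ^ n) 1 x = 1 := fun n => by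
    induction n with
    | zero => simp
    | succ n ih =>
      intro x hx
      rw [pow_succ, Module.End.mul_apply]
      rw [(hh.isWeightOn hY).transfer_pow_congr (f' := 1) (fun y hy => hh.transfer_one hy) n hx]
      exact ih x hx
  rw [hc, map_smul, Pi.smul_apply, h1 n x hx, smul_eq_mul, mul_one]

lemma IsEigenfunction.weightProd_eq (hh : IsEigenfunction Y φ P K h) (hY : Set.MapsTo shift Y Y)
    (n : ℕ) {z : ℕ → A} (hz : z ∈ Y) : weightProd (normWeight Y φ P h) n z =
      Real.exp (birkhoffSum shift φ n z - n * P) * h z / h (shift^[n] z) := by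
  induction n with
  | zero => simp [weightProd, (hh.pos hz).ne']
  | succ n ih =>
    have h₁ := (hh.pos (hY.iterate n hz)).ne'
    have h₂ : weightProd (normWeight Y φ P h) (n + 1) z =
      weightProd (normWeight Y φ P h) n z * normWeight Y φ P h (shift^[n] z) := by
      rw [weightProd, Finset.prod_range_succ, weightProd]
    rw [h₂, ih, normWeight, Set.indicator_of_mem (hY.iterate n hz), ← Function.iterate_succ_apply' shift n z,
      birkhoffSum_succ]
    rw [show birkhoffSum shift φ n z + φ (shift^[n] z) - ((n + 1 : ℕ) : ℝ) * P =
      (birkhoffSum shift φ n z - n * P) + (φ (shift^[n] z) - P) by push_cast; ring, Real.exp_add]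
    field_simp

lemma IsEigenfunction.weightProd_le (hh : IsEigenfunction Y φ P K h) (hY : Set.MapsTo shift Y Y)
    (n : ℕ) {z : ℕ → A} (hz : z ∈ Y) : weightProd (normWeight Y φ P h) n z ≤
      K ^ 2 * Real.exp (birkhoffSum shift φ n z - n * P) := by
  rw [hh.weightProd_eq hY n hz, div_le_iff₀ (hh.pos (hY.iterate n hz))]
  have hK := one_pos.trans_le hh.one_le
  have h₁ := hh.inv_le _ (hY.iterate n hz)
  rw [inv_le_iff_one_le_mul₀ hK] at h₁
  have h₂ := hh.le z hz
  have h₃ := Real.exp_pos (birkhoffSum shift φ n z - n * P)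
  calc _ ≤ Real.exp (birkhoffSum shift φ n z - n * P) * K * (h (shift^[n] z) * K) := by
        rw [mul_assoc]
        refine mul_le_mul_of_nonneg_left ?_ h₃.le
        nlinarith
    _ = _ := by ring

lemma IsEigenfunction.le_weightProd (hh : IsEigenfunction Y φ P K h) (hY : Set.MapsTo shift Y Y)
    (n : ℕ) {z : ℕ → A} (hz : z ∈ Y) :
    (K ^ 2)⁻¹ * Real.exp (birkhoffSum shift φ n z - n * P) ≤
      weightProd (normWeight Y φ P h) n z := by
  rw [hh.weightProd_eq hY n hz, le_div_iff₀ (hh.pos (hY.iterate n hz))]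
  have hK := one_pos.trans_le hh.one_le
  have h₁ := hh.inv_le _ hz
  have h₂ := hh.le _ (hY.iterate n hz)
  have h₃ := Real.exp_pos (birkhoffSum shift φ n z - n * P)
  calc _ ≤ (K ^ 2)⁻¹ * Real.exp (birkhoffSum shift φ n z - n * P) * K := by gcongr
    _ = Real.exp (birkhoffSum shift φ n z - n * P) * K⁻¹ := by field_simp
    _ ≤ _ := by gcongr

end SoficGibbs

/-! ### Stationary functionals and invariant measures -/

namespace SoficGibbs

open scoped CompactlySupported in
/-- A normalised positive functional on a compact space is the integral against a probability
measure. -/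
lemma exists_probabilityMeasure_integral_eq {Ω : Type*} [TopologicalSpace Ω] [CompactSpace Ω]
    [T2Space Ω] [MeasurableSpace Ω] [BorelSpace Ω] (L : (Ω → ℝ) →ₗ[ℝ] ℝ) (h1 : L 1 = 1)
    (hmono : ∀ f f' : Ω → ℝ, Continuous f → Continuous f' → f ≤ f' → L f ≤ L f') :
    ∃ μ : ProbabilityMeasure Ω, ∀ f : Ω → ℝ, Continuous f → ∫ x, f x ∂(μ : Measure Ω) = L f := by
  let L' : C_c(Ω, ℝ) →ₚ[ℝ] ℝ :=
    { toFun := fun f => L f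
      map_add' := fun f f' => by rw [← map_add]; rfl
      map_smul' := fun c f => by rw [RingHom.id_apply, ← map_smul]; rfl
      monotone' := fun f f' hff' => hmono _ _ f.continuous f'.continuous hff' }
  have hint : ∀ f : Ω → ℝ, Continuous f → ∫ x, f x ∂(RealRMK.rieszMeasure L') = L f :=
    fun f hf => RealRMK.integral_rieszMeasure L' ⟨⟨f, hf⟩, HasCompactSupport.of_compactSpace f⟩
  have hone := hint 1 continuous_one
  rw [h1] at hone
  simp only [Pi.one_apply, integral_const, smul_eq_mul, mul_one] at hone
  have : IsProbabilityMeasure (RealRMK.rieszMeasure L') := by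
    refine ⟨?_⟩
    rwa [measureReal_def, ENNReal.toReal_eq_one_iff] at hone
  exact ⟨⟨_, this⟩, hint⟩

variable {A : Type*}

/-- The sequences that agree with some point of `X` in the first `n` symbols. -/
def hull (X : Set (ℕ → A)) (n : ℕ) : Set (ℕ → A) := {z | ∃ y ∈ X, y ∈ PiNat.cylinder z n}

lemma subset_hull (X : Set (ℕ → A)) (n : ℕ) : X ⊆ hull X n :=
  fun x hx => ⟨x, hx, PiNat.self_mem_cylinder x n⟩

lemma continuous_shift [TopologicalSpace A] : Continuous (shift : (ℕ → A) → ℕ → A) :=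
  continuous_pi fun i => continuous_apply (i + 1)

lemma iInter_hull [TopologicalSpace A] {X : Set (ℕ → A)} (hX : IsClosed X) : ⋂ n, hull X n = X := by
  refine Set.Subset.antisymm (fun x hx => mem_of_forall_prefix hX (Set.mem_iInter.1 hx)) ?_
  exact Set.subset_iInter fun n => subset_hull X n

section
variable [TopologicalSpace A] [DiscreteTopology A]

lemma isClopen_piNat_cylinder (x : ℕ → A) (n : ℕ) :
    IsClopen (PiNat.cylinder (E := fun _ => A) x n) := by
  rw [PiNat.cylinder_eq_pi]
  refine ⟨isClosed_set_pi fun i _ => isClosed_discrete _, ?_⟩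
  exact isOpen_set_pi (Finset.finite_toSet _) fun i _ => isOpen_discrete _

lemma isClopen_of_forall_mem_cylinder {U : Set (ℕ → A)} {n : ℕ}
    (h : ∀ x y, y ∈ PiNat.cylinder x n → (x ∈ U → y ∈ U)) : IsClopen U := by
  refine ⟨⟨isOpen_iff_mem_nhds.2 fun x hx => ?_⟩, isOpen_iff_mem_nhds.2 fun x hx => ?_⟩
  · refine mem_of_superset ((isClopen_piNat_cylinder x n).isOpen.mem_nhds
      (PiNat.self_mem_cylinder x n)) fun y hy hyU => hx ?_
    exact h y x ((PiNat.mem_cylinder_comm _ _ _).1 hy) hyU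
  · exact mem_of_superset ((isClopen_piNat_cylinder x n).isOpen.mem_nhds
      (PiNat.self_mem_cylinder x n)) fun y hy => h x y hy hx

lemma isClopen_hull (X : Set (ℕ → A)) (n : ℕ) : IsClopen (hull X n) := by
  refine isClopen_of_forall_mem_cylinder (n := n) ?_
  rintro x y hxy ⟨z, hz, hzx⟩
  refine ⟨z, hz, ?_⟩
  rw [PiNat.mem_cylinder_iff_eq] at *
  rw [hzx, hxy]

lemma measure_eq_one_of_hull [MeasurableSpace (ℕ → A)] [OpensMeasurableSpace (ℕ → A)]
    {X : Set (ℕ → A)} (hX : IsClosed X) (μ : Measure (ℕ → A)) [IsProbabilityMeasure μ]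
    (h : ∀ n, μ (hull X n) = 1) : μ X = 1 := by
  have h₁ : ∀ᵐ x ∂μ, ∀ n, x ∈ hull X n := ae_all_iff.2 fun n =>
    (mem_ae_iff_prob_eq_one (isClopen_hull X n).isOpen.measurableSet).2 (h n)
  rw [← mem_ae_iff_prob_eq_one hX.measurableSet]
  filter_upwards [h₁] with x hx
  rw [← iInter_hull hX]
  exact Set.mem_iInter.2 hx

end

/-- A positive normalised functional on the functions bounded on `Y` that is invariant under the
transfer operator of the weight `g`. -/
structure IsStationary [Fintype A] (Y : Set (ℕ → A)) (g : (ℕ → A) → ℝ)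
    (L : ((ℕ → A) → ℝ) →ₗ[ℝ] ℝ) : Prop where
  mono : ∀ f f' : (ℕ → A) → ℝ, (∀ x ∈ Y, f x ≤ f' x) → (∃ M, ∀ x ∈ Y, |f x| ≤ M) →
    (∃ M, ∀ x ∈ Y, |f' x| ≤ M) → L f ≤ L f'
  const : ∀ c, L (fun _ => c) = c
  transfer_pow : ∀ f : (ℕ → A) → ℝ, (∃ M, ∀ x ∈ Y, |f x| ≤ M) → ∀ n, L ((transfer g ^ n) f) = L f

section
variable [Fintype A] {Y : Set (ℕ → A)} {φ : (ℕ → A) → ℝ} {C θ P K : ℝ} {l : ℕ}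
  {h : (ℕ → A) → ℝ} {L : ((ℕ → A) → ℝ) →ₗ[ℝ] ℝ}

lemma IsEigenfunction.abs_transfer_pow_le (hh : IsEigenfunction Y φ P K h)
    (hY : Set.MapsTo shift Y Y) {f : (ℕ → A) → ℝ} {M : ℝ} (hf : ∀ x ∈ Y, |f x| ≤ M) (n : ℕ)
    {x : ℕ → A} (hx : x ∈ Y) : |(transfer (normWeight Y φ P h) ^ n) f x| ≤ M := by
  have hw := hh.isWeightOn hY
  rw [abs_le]
  constructor
  · rw [← hh.transfer_pow_const hY (-M) n hx]
    exact hw.transfer_pow_mono (fun y hy => neg_le_of_abs_le (hf y hy)) n x hx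
  · conv_rhs => rw [← hh.transfer_pow_const hY M n hx]
    exact hw.transfer_pow_mono (fun y hy => le_of_abs_le (hf y hy)) n x hx

lemma IsEigenfunction.exists_isStationary (hh : IsEigenfunction Y φ P K h)
    (hY : Set.MapsTo shift Y Y) (hne : Y.Nonempty) :
    ∃ L, IsStationary Y (normWeight Y φ P h) L := by
  obtain ⟨x₀, hx₀⟩ := hne
  obtain ⟨B, hB⟩ := exists_isBanachLimit
  have hw := hh.isWeightOn hY
  let orb : ((ℕ → A) → ℝ) →ₗ[ℝ] (ℕ → ℝ) :=
    LinearMap.pi fun n => (LinearMap.proj x₀).comp (transfer (normWeight Y φ P h) ^ n)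
  have horb : ∀ f n, orb f n = (transfer (normWeight Y φ P h) ^ n) f x₀ := fun f n => rfl
  have hbd : ∀ f : (ℕ → A) → ℝ, (∃ M, ∀ x ∈ Y, |f x| ≤ M) → ∃ M, ∀ n, |orb f n| ≤ M := by
    rintro f ⟨M, hM⟩
    exact ⟨M, fun n => hh.abs_transfer_pow_le hY hM n hx₀⟩
  refine ⟨B.comp orb, fun f f' hff' hf hf' => ?_, fun c => ?_, fun f hf k => ?_⟩
  · exact hB.mono (fun n => hw.transfer_pow_mono hff' n x₀ hx₀) (hbd f hf) (hbd f' hf')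
  · rw [LinearMap.comp_apply, ← hB.const c]
    congr 1
    funext n
    rw [horb, hB.const, hh.transfer_pow_const hY c n hx₀]
  · rw [LinearMap.comp_apply, LinearMap.comp_apply, ← hB.comp_add (hbd f hf) k]
    congr 1
    funext n
    rw [horb, horb, pow_add, Module.End.mul_apply]

lemma IsStationary.comp_shift (hL : IsStationary Y (normWeight Y φ P h) L)
    (hh : IsEigenfunction Y φ P K h) (hY : Set.MapsTo shift Y Y)
    {f : (ℕ → A) → ℝ} (hf : ∃ M, ∀ x ∈ Y, |f x| ≤ M) : L (fun x => f (shift x)) = L f := by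
  obtain ⟨M, hM⟩ := hf
  have hbd : ∃ M, ∀ x ∈ Y, |f (shift x)| ≤ M := ⟨M, fun x hx => hM _ (hY hx)⟩
  have heq : ∀ x ∈ Y, (transfer (normWeight Y φ P h) ^ 1) (fun x => f (shift x)) x = f x :=
    fun x hx => by
      have h₁ := transfer_pow_mul_comp (normWeight Y φ P h) 1 f 1 x
      rw [pow_one, hh.transfer_one hx, one_mul] at h₁
      simpa using h₁
  have hbd' : ∃ M, ∀ x ∈ Y, |(transfer (normWeight Y φ P h) ^ 1) (fun x => f (shift x)) x| ≤ M :=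
    ⟨M, fun x hx => by rw [heq x hx]; exact hM x hx⟩
  rw [← hL.transfer_pow _ hbd 1]
  exact le_antisymm (hL.mono _ _ (fun x hx => (heq x hx).le) hbd' ⟨M, hM⟩)
    (hL.mono _ _ (fun x hx => (heq x hx).ge) ⟨M, hM⟩ hbd')

/-- A stationary functional is the integral against an invariant probability measure on `Y`. -/
lemma IsStationary.exists_measure [TopologicalSpace A] [DiscreteTopology A] [MeasurableSpace A]
    [BorelSpace A] (hL : IsStationary Y (normWeight Y φ P h) L) (hh : IsEigenfunction Y φ P K h)
    (hY : IsSubshift Y) : ∃ μ : ProbabilityMeasure (ℕ → A), IsInvariantOn Y μ ∧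
      ∀ U : Set (ℕ → A), IsClopen U → (μ : Measure (ℕ → A)).real U = L (U.indicator 1) := by
  have hbd : ∀ f : (ℕ → A) → ℝ, Continuous f → ∃ M, ∀ x ∈ Y, |f x| ≤ M := fun f hf => by
    obtain ⟨M, hM⟩ := (isCompact_univ.image hf.abs).bddAbove
    exact ⟨M, fun x _ => hM ⟨x, trivial, rfl⟩⟩
  obtain ⟨μ, hμ⟩ := exists_probabilityMeasure_integral_eq L (hL.const 1)
    fun f f' hf hf' hff' => hL.mono f f' (fun x _ => hff' x) (hbd f hf) (hbd f' hf')
  have hU : ∀ U : Set (ℕ → A), IsClopen U → (μ : Measure (ℕ → A)).real U = L (U.indicator 1) :=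
    fun U hU => by
      rw [← hμ _ ((continuous_indicator (f := (1 : (ℕ → A) → ℝ))
        (by simp [hU.frontier_eq]) continuous_one.continuousOn)),
        integral_indicator_one hU.isOpen.measurableSet]
  have hm : Measurable (shift : (ℕ → A) → ℕ → A) := continuous_shift.measurable
  refine ⟨μ, ⟨⟨hm, ?_⟩, ?_⟩, hU⟩
  · have := Measure.isProbabilityMeasure_map (μ := (μ : Measure (ℕ → A))) hm.aemeasurable
    refine ext_of_forall_integral_eq_of_IsFiniteMeasure fun f => ?_
    rw [integral_map hm.aemeasurable f.continuous.aestronglyMeasurable,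
      hμ (fun x => f (shift x)) (f.continuous.comp continuous_shift), hμ _ f.continuous]
    exact hL.comp_shift hh hY.mapsTo (hbd f f.continuous)
  · refine measure_eq_one_of_hull hY.isCompact.isClosed _ fun n => ?_
    have h₁ := hU _ (isClopen_hull Y n)
    have h₂ : L ((hull Y n).indicator 1) = 1 := by
      have hb : ∃ M : ℝ, ∀ x ∈ Y, |(hull Y n).indicator (1 : (ℕ → A) → ℝ) x| ≤ M :=
        ⟨1, fun x hx => by simp [Set.indicator_of_mem (subset_hull Y n hx)]⟩
      have he : ∀ x ∈ Y, (hull Y n).indicator (1 : (ℕ → A) → ℝ) x = 1 := fun x hx => by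
        simp [Set.indicator_of_mem (subset_hull Y n hx)]
      refine le_antisymm ?_ ?_
      · rw [← hL.const 1]
        exact hL.mono _ _ (fun x hx => (he x hx).le) hb ⟨1, by simp⟩
      · conv_lhs => rw [← hL.const 1]
        exact hL.mono _ _ (fun x hx => (he x hx).ge) ⟨1, by simp⟩ hb
    rw [h₂, measureReal_def, ENNReal.toReal_eq_one_iff] at h₁
    exact h₁

end
end SoficGibbs

/-! ### The Gibbs property -/

namespace SoficGibbs

variable {A : Type*} {Y : Set (ℕ → A)} {φ : (ℕ → A) → ℝ} {C θ P K D : ℝ} {l : ℕ}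
  {h : (ℕ → A) → ℝ} {L : ((ℕ → A) → ℝ) →ₗ[ℝ] ℝ}

/-- A Gibbs measure on `Y` with constant `D` and pressure `P`. Here the cylinders are those of the
full shift, and the one of length zero is included. -/
structure IsGibbsWith [MeasurableSpace A] (Y : Set (ℕ → A)) (φ : (ℕ → A) → ℝ) (D P : ℝ)
    (μ : ProbabilityMeasure (ℕ → A)) : Prop where
  invariantOn : IsInvariantOn Y μ
  one_le : 1 ≤ D
  le_cylinder : ∀ x ∈ Y, ∀ n : ℕ, D⁻¹ * Real.exp (birkhoffSum shift φ n x - n * P) ≤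
    (μ : Measure (ℕ → A)).real (PiNat.cylinder x n)
  cylinder_le : ∀ x ∈ Y, ∀ n : ℕ, (μ : Measure (ℕ → A)).real (PiNat.cylinder x n) ≤
    D * Real.exp (birkhoffSum shift φ n x - n * P)

lemma orbitSum_eq (φ : (ℕ → A) → ℝ) (k : ℕ) (x : ℕ → A) :
    orbitSum φ k x = birkhoffSum shift φ (k + 1) x := rfl

lemma IsInvariantOn.ae_mem [MeasurableSpace A] [TopologicalSpace A] [DiscreteTopology A]
    [BorelSpace A] [Finite A] {μ : ProbabilityMeasure (ℕ → A)} (hY : IsClosed Y)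
    (h : IsInvariantOn Y μ) : ∀ᵐ x ∂(μ : Measure (ℕ → A)), x ∈ Y :=
  (mem_ae_iff_prob_eq_one hY.measurableSet).2 h.carried

lemma IsInvariantOn.real_cylinder_word [MeasurableSpace A] [TopologicalSpace A]
    [DiscreteTopology A] [BorelSpace A] [Finite A] {μ : ProbabilityMeasure (ℕ → A)}
    (hY : IsClosed Y) (h : IsInvariantOn Y μ) (x : ℕ → A) (n : ℕ) :
    (μ : Measure (ℕ → A)).real (cylinder Y (word x 0 n)) =
      (μ : Measure (ℕ → A)).real (PiNat.cylinder x n) := by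
  rw [cylinder_word]
  refine measureReal_congr ?_
  filter_upwards [h.ae_mem hY] with z hz
  exact propext ⟨fun h => h.2, fun h => ⟨hz, h⟩⟩

lemma isGibbs_iff [MeasurableSpace A] [TopologicalSpace A] [DiscreteTopology A]
    [BorelSpace A] [Finite A] {μ : ProbabilityMeasure (ℕ → A)} (hY : IsClosed Y) :
    IsGibbs Y φ μ ↔ ∃ D P, IsGibbsWith Y φ D P μ := by
  constructor
  · rintro ⟨hinv, C, P, hC, h⟩
    refine ⟨max C 1, P, hinv, le_max_right _ _, fun x hx n => ?_, fun x hx n => ?_⟩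
    · rcases n with _ | n
      · simp only [PiNat.cylinder_zero, birkhoffSum_zero, Nat.cast_zero, zero_mul, sub_zero,
          Real.exp_zero, mul_one, probReal_univ]
        exact inv_le_one_of_one_le₀ (le_max_right _ _)
      · have h₁ := (h x hx n).1
        rw [hinv.real_cylinder_word hY, le_div_iff₀ (Real.exp_pos _), orbitSum_eq] at h₁
        push_cast
        refine le_trans ?_ h₁
        gcongr
        exact le_max_left _ _
    · rcases n with _ | n
      · simp only [PiNat.cylinder_zero, birkhoffSum_zero, Nat.cast_zero, zero_mul, sub_zero,
          Real.exp_zero, mul_one, probReal_univ]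
        exact le_max_right _ _
      · have h₁ := (h x hx n).2
        rw [hinv.real_cylinder_word hY, div_le_iff₀ (Real.exp_pos _), orbitSum_eq] at h₁
        push_cast
        refine h₁.trans ?_
        gcongr
        exact le_max_left _ _
  · rintro ⟨D, P, h⟩
    refine ⟨h.invariantOn, D, P, one_pos.trans_le h.one_le, fun x hx k => ?_⟩
    have h₁ := h.le_cylinder x hx (k + 1)
    have h₂ := h.cylinder_le x hx (k + 1)
    push_cast at h₁ h₂
    rw [h.invariantOn.real_cylinder_word hY, le_div_iff₀ (Real.exp_pos _),
      div_le_iff₀ (Real.exp_pos _), orbitSum_eq]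
    exact ⟨h₁, h₂⟩

section
variable [Fintype A]

lemma IsEigenfunction.transfer_pow_indicator_le (hh : IsEigenfunction Y φ P K h)
    (hY : Set.MapsTo shift Y Y) (hφ : IsHolderWith φ C θ) (x : ℕ → A) (n : ℕ) {y : ℕ → A}
    (hy : y ∈ Y) : (transfer (normWeight Y φ P h) ^ n) ((PiNat.cylinder x n).indicator 1) y ≤
      K ^ 2 * Real.exp (C / (1 - θ)) * Real.exp (birkhoffSum shift φ n x - n * P) := by
  have hw := hh.isWeightOn hY
  rw [transfer_pow_apply, Finset.sum_eq_single fun i : Fin n => x i]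
  · set z := join (fun i : Fin n => x i) y
    have hzx : z ∈ PiNat.cylinder x n :=
      PiNat.mem_cylinder_iff.2 fun i hi => join_of_lt _ _ hi
    rw [Set.indicator_of_mem hzx, Pi.one_apply, mul_one]
    by_cases hz : z ∈ Y
    · refine (hh.weightProd_le hY n hz).trans ?_
      rw [mul_assoc, ← Real.exp_add]
      gcongr
      linarith [le_of_abs_le (hφ.abs_birkhoffSum_sub_le hzx)]
    · rcases eq_or_ne n 0 with rfl | hn
      · exact absurd (by simpa [z] using hy) hz
      · rw [weightProd_eq_zero hw hn hz]
        positivity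
  · intro w _ hwx
    rw [Set.indicator_of_notMem, mul_zero]
    intro hmem
    refine hwx (funext fun i => ?_)
    rw [← PiNat.mem_cylinder_iff.1 hmem i i.2, join_of_lt _ _ i.2]
  · simp

lemma IsEigenfunction.le_transfer_pow_indicator (hh : IsEigenfunction Y φ P K h)
    (hY : Set.MapsTo shift Y Y) (hφ : IsHolderWith φ C θ) (hl : IsGluing Y l) {x : ℕ → A}
    (hx : x ∈ Y) (n : ℕ) {y : ℕ → A} (hy : y ∈ Y) :
    (K ^ 2 * Real.exp (C / (1 - θ) + l * (C + |P|)))⁻¹ *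
        Real.exp (birkhoffSum shift φ n x - n * P) ≤
      (transfer (normWeight Y φ P h) ^ (n + l)) ((PiNat.cylinder x n).indicator 1) y := by
  obtain ⟨z, hz, hzx, rfl⟩ := hl n x hx y hy
  have h₁ := (hh.isWeightOn hY).weightProd_mul_le hY (f := (PiNat.cylinder x n).indicator 1)
    (fun _ _ => Set.indicator_nonneg (fun _ _ => zero_le_one) _) (n + l) hz
  rw [Set.indicator_of_mem hzx, Pi.one_apply, mul_one] at h₁
  refine le_trans ?_ ((hh.le_weightProd hY (n + l) hz).trans h₁)
  have hK := one_pos.trans_le hh.one_le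
  rw [mul_inv, ← Real.exp_neg, mul_assoc, ← Real.exp_add, birkhoffSum_add]
  gcongr
  have h₂ := neg_le_of_abs_le (hφ.abs_birkhoffSum_sub_le hzx)
  have h₃ := neg_le_of_abs_le (hφ.abs_birkhoffSum_le l (shift^[n] z))
  have h₄ : (l : ℝ) * P ≤ l * |P| := by gcongr; exact le_abs_self P
  push_cast
  linarith

variable [TopologicalSpace A] [DiscreteTopology A]

lemma IsStationary.isGibbsWith [MeasurableSpace A]
    (hL : IsStationary Y (normWeight Y φ P h) L) (hh : IsEigenfunction Y φ P K h)
    (hY : IsSubshift Y) (hφ : IsHolderWith φ C θ) (hl : IsGluing Y l) {R : ℝ} (hP : |P| ≤ R)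
    {μ : ProbabilityMeasure (ℕ → A)} (hinv : IsInvariantOn Y μ)
    (hμ : ∀ U : Set (ℕ → A), IsClopen U → (μ : Measure (ℕ → A)).real U = L (U.indicator 1)) :
    IsGibbsWith Y φ (K ^ 2 * Real.exp (C / (1 - θ) + l * (C + R))) P μ := by
  have hw := hh.isWeightOn hY.mapsTo
  have hV : 0 ≤ C / (1 - θ) := div_nonneg hφ.nonneg (sub_pos.2 hφ.lt_one).le
  have hR : 0 ≤ R := (abs_nonneg P).trans hP
  have hl0 : 0 ≤ (l : ℝ) * (C + R) := mul_nonneg (Nat.cast_nonneg l) (add_nonneg hφ.nonneg hR)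
  have hb : ∀ x n, ∀ y ∈ Y, |(PiNat.cylinder (E := fun _ => A) x n).indicator
      (1 : (ℕ → A) → ℝ) y| ≤ 1 := fun x n y _ => by
    by_cases hy : y ∈ PiNat.cylinder (E := fun _ => A) x n <;> simp [hy]
  have hbt : ∀ x n k, ∃ M, ∀ y ∈ Y, |(transfer (normWeight Y φ P h) ^ k)
      ((PiNat.cylinder x n).indicator 1) y| ≤ M := fun x n k =>
    ⟨1, fun y hy => hh.abs_transfer_pow_le hY.mapsTo (hb x n) k hy⟩
  refine ⟨hinv, ?_, fun x hx n => ?_, fun x hx n => ?_⟩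
  · exact one_le_mul_of_one_le_of_one_le (one_le_pow₀ hh.one_le) (Real.one_le_exp (by linarith))
  · rw [hμ _ (isClopen_piNat_cylinder x n), ← hL.transfer_pow _ ⟨1, hb x n⟩ (n + l)]
    refine le_trans ?_ ((hL.const _).symm.le.trans (hL.mono _ _
      (fun y hy => hh.le_transfer_pow_indicator hY.mapsTo hφ hl hx n hy)
      ⟨_, fun _ _ => le_rfl⟩ (hbt x n _)))
    have hK := one_pos.trans_le hh.one_le
    have hC := hφ.nonneg
    gcongr
  · rw [hμ _ (isClopen_piNat_cylinder x n), ← hL.transfer_pow _ ⟨1, hb x n⟩ n]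
    refine (hL.mono _ _ (fun y hy => hh.transfer_pow_indicator_le hY.mapsTo hφ x n hy)
      (hbt x n _) ⟨_, fun _ _ => le_rfl⟩).trans ((hL.const _).le.trans ?_)
    gcongr
    linarith

/-- The constant in the Gibbs property. -/
noncomputable def gibbsConst (A : Type*) [Fintype A] (C θ : ℝ) (l : ℕ) : ℝ :=
  (partitionConst A C θ l ^ 2) ^ 2 * Real.exp (C / (1 - θ) + l * (C + pressureConst A C θ l))

/-- Gibbs measures exist on all subshifts with the gluing property, with a constant and a bound on
the pressure that depend on the subshift only through the gap `l`. -/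
lemma exists_isGibbsWith [MeasurableSpace A] [BorelSpace A] (hY : IsSubshift Y)
    (hφ : IsHolderWith φ C θ) (hl : IsGluing Y l) (hne : Y.Nonempty) :
    ∃ P μ, |P| ≤ pressureConst A C θ l ∧ IsGibbsWith Y φ (gibbsConst A C θ l) P μ := by
  obtain ⟨P, h, hP, hh, -⟩ := exists_isEigenfunction hφ hY.mapsTo hl hne
  obtain ⟨L, hL⟩ := hh.exists_isStationary hY.mapsTo hne
  obtain ⟨μ, hinv, hμ⟩ := hL.exists_measure hh hY
  exact ⟨P, μ, hP, hL.isGibbsWith hh hY hφ hl hP hinv hμ⟩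

end
end SoficGibbs

/-! ### Ergodicity and uniqueness of Gibbs measures -/

namespace SoficGibbs

section Comparison
variable {A : Type*} [Finite A] [TopologicalSpace A] [DiscreteTopology A] [MeasurableSpace A]
  [BorelSpace A]

/-- Comparison of two measures on the cylinders of length `n` passes to the sets that depend on the
first `n` symbols. -/
lemma measure_le_of_forall_cylinder_le {μ ρ : Measure (ℕ → A)} {n : ℕ}
    (h : ∀ x, μ (PiNat.cylinder x n) ≤ ρ (PiNat.cylinder x n)) {E : Set (ℕ → A)}
    (hE : ∀ x y, y ∈ PiNat.cylinder x n → (x ∈ E → y ∈ E)) : μ E ≤ ρ E := by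
  rcases E.eq_empty_or_nonempty with rfl | ⟨x₀, -⟩
  · simp
  classical
  have := Fintype.ofFinite A
  let c : (Fin n → A) → Set (ℕ → A) := fun w => PiNat.cylinder (join w x₀) n
  have hc : ∀ w z, z ∈ c w ↔ (fun i : Fin n => z i) = w := fun w z => by
    simp only [c, PiNat.mem_cylinder_iff, funext_iff]
    exact ⟨fun h i => by rw [h i i.2, join_of_lt _ _ i.2],
      fun h i hi => by rw [join_of_lt _ _ hi]; exact h ⟨i, hi⟩⟩
  let s : Finset (Fin n → A) := Finset.univ.filter fun w => join w x₀ ∈ E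
  have hEs : E = ⋃ w ∈ s, c w := by
    ext z
    simp only [Set.mem_iUnion, hc, exists_prop, s, Finset.mem_filter, Finset.mem_univ, true_and]
    have h₁ : z ∈ PiNat.cylinder (join (fun i : Fin n => z i) x₀) n := (hc _ z).2 rfl
    constructor
    · exact fun hz => ⟨_, hE _ _ ((PiNat.mem_cylinder_comm _ _ _).1 h₁) hz, rfl⟩
    · rintro ⟨w, hw, rfl⟩
      exact hE _ _ h₁ hw
  have hsum : ∀ m : Measure (ℕ → A), m E = ∑ w ∈ s, m (c w) := fun m => by
    conv_lhs => rw [hEs]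
    refine measure_biUnion_finset (fun w _ w' _ hww' => ?_)
      fun w _ => (isClopen_piNat_cylinder _ _).isOpen.measurableSet
    refine Set.disjoint_left.2 fun z hz hz' => hww' ?_
    rw [← (hc w z).1 hz, (hc w' z).1 hz']
  rw [hsum, hsum]
  exact Finset.sum_le_sum fun w _ => h _

/-- Comparison of two finite measures on all cylinders passes to all sets. -/
lemma measure_le_of_forall_cylinder {μ ρ : Measure (ℕ → A)} [IsFiniteMeasure ρ]
    (h : ∀ x n, μ (PiNat.cylinder x n) ≤ ρ (PiNat.cylinder x n)) : μ ≤ ρ := by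
  have hopen : ∀ U : Set (ℕ → A), IsOpen U → μ U ≤ ρ U := fun U hU => by
    let V : ℕ → Set (ℕ → A) := fun n => {x | PiNat.cylinder x n ⊆ U}
    have hV : Monotone V := fun m n hmn x hx => (PiNat.cylinder_anti x hmn).trans hx
    have hUV : U = ⋃ n, V n := by
      refine Set.Subset.antisymm (fun x hx => ?_) (Set.iUnion_subset fun n x hx =>
        hx (PiNat.self_mem_cylinder x n))
      obtain ⟨_, ⟨y, n, rfl⟩, hxy, hyU⟩ :=
        (PiNat.isTopologicalBasis_cylinders (fun _ : ℕ => A)).exists_subset_of_mem_open hx hU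
      refine Set.mem_iUnion.2 ⟨n, ?_⟩
      rw [← PiNat.mem_cylinder_iff_eq.1 hxy] at hyU
      exact hyU
    rw [hUV, hV.measure_iUnion, hV.measure_iUnion]
    refine iSup_mono fun n => measure_le_of_forall_cylinder_le (fun x => h x n) ?_
    intro x y hxy hx
    rw [PiNat.mem_cylinder_iff_eq] at hxy
    simpa only [V, Set.mem_ofPred_eq, hxy] using hx
  refine Measure.le_intro fun B _ _ => ?_
  rw [B.measure_eq_iInf_isOpen ρ]
  exact le_iInf₂ fun U hBU => le_iInf fun hU => (measure_mono hBU).trans (hopen U hU)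

end Comparison

variable {A : Type*} {Y : Set (ℕ → A)} {φ : (ℕ → A) → ℝ} {C θ P P' D D' : ℝ} {l : ℕ}

section
variable [MeasurableSpace A] {μ ν : ProbabilityMeasure (ℕ → A)}

/-- The Gibbs property gives a lower bound for the measure of points that visit a second cylinder a
fixed time after leaving a first one. -/
lemma IsGibbsWith.mul_le_inter (hμ : IsGibbsWith Y φ D P μ) (hφ : IsHolderWith φ C θ)
    (hl : IsGluing Y l) {x y : ℕ → A} (hx : x ∈ Y) (hy : y ∈ Y) (p q : ℕ) :
    (D ^ 3)⁻¹ * Real.exp (-(C / (1 - θ) + l * (C + |P|))) *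
        (μ : Measure (ℕ → A)).real (PiNat.cylinder x p) *
        (μ : Measure (ℕ → A)).real (PiNat.cylinder y q) ≤
      (μ : Measure (ℕ → A)).real
        (PiNat.cylinder x p ∩ shift^[p + l] ⁻¹' PiNat.cylinder y q) := by
  obtain ⟨z, hz, hzx, rfl⟩ := hl p x hx y hy
  have hsub : PiNat.cylinder z (p + l + q) ⊆
      PiNat.cylinder x p ∩ shift^[p + l] ⁻¹' PiNat.cylinder (shift^[p + l] z) q := by
    intro t ht
    rw [PiNat.mem_cylinder_iff] at ht hzx
    refine ⟨PiNat.mem_cylinder_iff.2 fun i hi => (ht i (by omega)).trans (hzx i hi),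
      PiNat.mem_cylinder_iff.2 fun i hi => ?_⟩
    rw [shift_iterate_apply, shift_iterate_apply]
    exact ht _ (by omega)
  refine le_trans ?_ ((hμ.le_cylinder z hz (p + l + q)).trans (measureReal_mono hsub))
  have hD := one_pos.trans_le hμ.one_le
  have h₁ := hμ.cylinder_le x hx p
  have h₂ := hμ.cylinder_le _ hy q
  have h₃ := neg_le_of_abs_le (hφ.abs_birkhoffSum_sub_le hzx)
  have h₄ := neg_le_of_abs_le (hφ.abs_birkhoffSum_le l (shift^[p] z))
  have h₅ : (l : ℝ) * P ≤ l * |P| := by gcongr; exact le_abs_self P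
  calc _ ≤ (D ^ 3)⁻¹ * Real.exp (-(C / (1 - θ) + l * (C + |P|))) *
        (D * Real.exp (birkhoffSum shift φ p x - p * P)) *
        (D * Real.exp (birkhoffSum shift φ q (shift^[p + l] z) - q * P)) := by gcongr
    _ = D⁻¹ * Real.exp (-(C / (1 - θ) + l * (C + |P|)) +
        (birkhoffSum shift φ p x - p * P) +
        (birkhoffSum shift φ q (shift^[p + l] z) - q * P)) := by
      rw [Real.exp_add, Real.exp_add]; field_simp
    _ ≤ _ := by
      gcongr
      rw [birkhoffSum_add, birkhoffSum_add]
      push_cast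
      linarith

variable [TopologicalSpace A] [DiscreteTopology A] [BorelSpace A] [Finite A]

/-- A cylinder is null unless it is the cylinder of a point of `Y`. -/
lemma IsInvariantOn.cylinder_eq_or_null (hY : IsClosed Y) (hμ : IsInvariantOn Y μ) (x : ℕ → A)
    (n : ℕ) : (∃ y ∈ Y, PiNat.cylinder x n = PiNat.cylinder y n) ∨
      (μ : Measure (ℕ → A)) (PiNat.cylinder x n) = 0 := by
  by_cases h : ∃ y ∈ Y, y ∈ PiNat.cylinder x n
  · obtain ⟨y, hy, hyx⟩ := h
    exact Or.inl ⟨y, hy, (PiNat.mem_cylinder_iff_eq.1 hyx).symm⟩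
  · right
    refine measure_mono_null (t := Yᶜ) (fun z hz hzY => h ⟨z, hzY, hz⟩) ?_
    exact hμ.ae_mem hY

lemma IsGibbsWith.cylinder_le_mul (hY : IsClosed Y) (hμ : IsGibbsWith Y φ D P μ)
    (hν : IsGibbsWith Y φ D' P' ν) (x : ℕ → A) (n : ℕ) :
    (ν : Measure (ℕ → A)) (PiNat.cylinder x n) ≤
      ENNReal.ofReal (D * D' * Real.exp (n * (P - P'))) *
        (μ : Measure (ℕ → A)) (PiNat.cylinder x n) := by
  have hD := one_pos.trans_le hμ.one_le
  have hD' := one_pos.trans_le hν.one_le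
  rcases hν.invariantOn.cylinder_eq_or_null hY x n with ⟨y, hy, hxy⟩ | h
  · rw [hxy, ← ofReal_measureReal, ← ofReal_measureReal, ← ENNReal.ofReal_mul (by positivity)]
    refine ENNReal.ofReal_le_ofReal ((hν.cylinder_le y hy n).trans ?_)
    have h₁ := mul_le_mul_of_nonneg_left (hμ.le_cylinder y hy n)
      (show 0 ≤ D * D' * Real.exp (n * (P - P')) by positivity)
    refine le_trans (le_of_eq ?_) h₁
    rw [show birkhoffSum shift φ n y - n * P' =
      n * (P - P') + (birkhoffSum shift φ n y - n * P) by ring, Real.exp_add]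
    field_simp
  · rw [h]; exact zero_le

/-- The pressure of a Gibbs measure is determined by the potential. -/
lemma IsGibbsWith.pressure_le (hY : IsClosed Y) (hμ : IsGibbsWith Y φ D P μ)
    (hν : IsGibbsWith Y φ D' P' ν) : P' ≤ P := by
  by_contra hlt
  have hDD : 0 < D * D' := mul_pos (one_pos.trans_le hμ.one_le) (one_pos.trans_le hν.one_le)
  have h₁ : ∀ n : ℕ, 1 ≤ D * D' * Real.exp (n * (P - P')) := fun n => by
    have h₂ := measure_le_of_forall_cylinder_le (n := n) (μ := (ν : Measure (ℕ → A)))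
      (ρ := ENNReal.ofReal (D * D' * Real.exp (n * (P - P'))) • (μ : Measure (ℕ → A)))
      (fun x => by
        rw [Measure.smul_apply, smul_eq_mul]; exact hμ.cylinder_le_mul hY hν x n)
      (E := Set.univ) (fun _ _ _ _ => trivial)
    rw [Measure.smul_apply, measure_univ, measure_univ, smul_eq_mul, mul_one] at h₂
    exact ENNReal.one_le_ofReal.1 h₂
  have h₂ : Tendsto (fun n : ℕ => D * D' * Real.exp (n * (P - P'))) atTop (𝓝 (D * D' * 0)) := by
    refine (Real.tendsto_exp_atBot.comp ?_).const_mul _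
    exact tendsto_natCast_atTop_atTop.atTop_mul_const_of_neg (by linarith)
  rw [mul_zero] at h₂
  exact absurd (ge_of_tendsto' h₂ h₁) (by norm_num)

/-- Gibbs measures are ergodic. For an invariant set `B`, the lower bound of
`IsGibbsWith.mul_le_inter` extends first to `T⁻ⁿ B = B` in place of the second cylinder, then to
`Bᶜ` in place of the first one. -/
lemma IsGibbsWith.ergodic (hY : IsClosed Y) (hμ : IsGibbsWith Y φ D P μ)
    (hφ : IsHolderWith φ C θ) (hl : IsGluing Y l) : Ergodic shift (μ : Measure (ℕ → A)) := by
  have hpres := hμ.invariantOn.measurePreserving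
  set m : Measure (ℕ → A) := (μ : Measure (ℕ → A)) with hm
  have hD := one_pos.trans_le hμ.one_le
  set c : ℝ := (D ^ 3)⁻¹ * Real.exp (-(C / (1 - θ) + l * (C + |P|))) with hc
  have hc0 : 0 < c := by positivity
  have hcyl : ∀ (x : ℕ → A) (p : ℕ) (B : Set (ℕ → A)), MeasurableSet B →
      ENNReal.ofReal c * m (PiNat.cylinder x p) * m B ≤
        m (PiNat.cylinder x p ∩ shift^[p + l] ⁻¹' B) := by
    intro x p B hB
    rcases hμ.invariantOn.cylinder_eq_or_null hY x p with ⟨x', hx', hxx'⟩ | h0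
    · rw [hxx']
      have hms := (isClopen_piNat_cylinder x' p).isOpen.measurableSet
      have hit : Measurable (shift^[p + l] : (ℕ → A) → ℕ → A) := hpres.measurable.iterate _
      have h₁ : (ENNReal.ofReal c * m (PiNat.cylinder x' p)) • m ≤
          (m.restrict (PiNat.cylinder x' p)).map shift^[p + l] := by
        refine measure_le_of_forall_cylinder fun y q => ?_
        rw [Measure.map_apply hit (isClopen_piNat_cylinder y q).isOpen.measurableSet,
          Measure.restrict_apply' hms, Measure.smul_apply, smul_eq_mul, Set.inter_comm]
        rcases hμ.invariantOn.cylinder_eq_or_null hY y q with ⟨y', hy', hyy'⟩ | h0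
        · rw [hyy', ← ofReal_measureReal, ← ofReal_measureReal, ← ofReal_measureReal,
            ← ENNReal.ofReal_mul hc0.le, ← ENNReal.ofReal_mul (by positivity)]
          exact ENNReal.ofReal_le_ofReal (hμ.mul_le_inter hφ hl hx' hy' p q)
        · rw [h0, mul_zero]; exact zero_le
      have h₂ := h₁ B
      rwa [Measure.map_apply hit hB, Measure.restrict_apply' hms, Measure.smul_apply,
        smul_eq_mul, Set.inter_comm] at h₂
    · rw [h0, mul_zero, zero_mul]; exact zero_le
  refine ⟨hpres, ⟨fun {B} hB hinv => ?_⟩⟩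
  have h₁ : (ENNReal.ofReal c * m B) • m ≤ m.restrict B := by
    refine measure_le_of_forall_cylinder fun x p => ?_
    have h₂ := hcyl x p B hB
    rw [Function.IsFixedPt.preimage_iterate hinv] at h₂
    rw [Measure.restrict_apply' hB, Measure.smul_apply, smul_eq_mul]
    calc _ = ENNReal.ofReal c * m (PiNat.cylinder x p) * m B := by ring
      _ ≤ _ := h₂
  have h₂ := h₁ Bᶜ
  rw [Measure.restrict_apply' hB, Set.compl_inter_self, measure_empty, Measure.smul_apply,
    smul_eq_mul, nonpos_iff_eq_zero, mul_eq_zero, mul_eq_zero, ENNReal.ofReal_eq_zero] at h₂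
  rw [Filter.eventuallyConst_set']
  rcases h₂ with (h₂ | h₂) | h₂
  · exact absurd h₂ (not_le.2 hc0)
  · exact Or.inl (ae_eq_empty.2 h₂)
  · exact Or.inr (ae_eq_univ.2 h₂)

/-- Uniqueness of Gibbs measures. -/
lemma IsGibbsWith.eq (hY : IsClosed Y) (hφ : IsHolderWith φ C θ) (hl : IsGluing Y l)
    (hμ : IsGibbsWith Y φ D P μ) (hν : IsGibbsWith Y φ D' P' ν) : ν = μ := by
  have hP : P = P' := le_antisymm (hν.pressure_le hY hμ) (hμ.pressure_le hY hν)
  have hle : (ν : Measure (ℕ → A)) ≤ ENNReal.ofReal (D * D') • (μ : Measure (ℕ → A)) := by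
    have : IsFiniteMeasure (ENNReal.ofReal (D * D') • (μ : Measure (ℕ → A))) :=
      Measure.smul_finite _ ENNReal.ofReal_ne_top
    refine measure_le_of_forall_cylinder fun x n => ?_
    have h₁ := hμ.cylinder_le_mul hY hν x n
    rwa [hP, sub_self, mul_zero, Real.exp_zero, mul_one] at h₁
  have hac : (ν : Measure (ℕ → A)) ≪ (μ : Measure (ℕ → A)) :=
    (Measure.absolutelyContinuous_of_le hle).trans
      (Measure.AbsolutelyContinuous.rfl.smul_left _)
  have heq : (ν : Measure (ℕ → A)) = (μ : Measure (ℕ → A)) :=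
    (hμ.ergodic hY hφ hl).eq_of_absolutelyContinuous hν.invariantOn.measurePreserving hac
  exact Subtype.ext heq

end
end SoficGibbs

/-! ### Finite type approximations and their limits -/

namespace SoficGibbs

section Gluing
variable {A : Type*} {X Y : Set (ℕ → A)} {l : ℕ}

/-- The part of the specification property that the argument uses: admissible words can be joined
in `X` by words of length `l`. -/
def IsWordGluing (X : Set (ℕ → A)) (l : ℕ) : Prop :=
  ∀ u ∈ language X, ∀ v ∈ language X, ∃ c ∈ X,
    word c 0 u.length = u ∧ word c (u.length + l) v.length = v

lemma IsSpecified.exists_isWordGluing (h : IsSpecified X) : ∃ l, IsWordGluing X l := by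
  obtain ⟨l, h⟩ := h
  refine ⟨l, fun u hu v hv => ?_⟩
  obtain ⟨c, hc, -, h₁, h₂⟩ := h u hu v hv l l le_rfl le_rfl
  exact ⟨c, hc, h₁, h₂⟩

lemma IsGluing.of_pos (hY : Set.MapsTo shift Y Y)
    (h : ∀ n, 0 < n → ∀ y ∈ Y, ∀ x ∈ Y, ∃ z ∈ Y, z ∈ PiNat.cylinder y n ∧ shift^[n + l] z = x) :
    IsGluing Y l := by
  intro n y hy x hx
  rcases Nat.eq_zero_or_pos n with rfl | hn
  · obtain ⟨z, hz, -, hzx⟩ := h 1 one_pos y hy x hx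
    refine ⟨shift z, hY hz, by simp, ?_⟩
    rw [← Function.iterate_succ_apply, zero_add, ← hzx, add_comm 1 l]
  · exact h n hn y hy x hx

lemma admissible_word_mem_language {m j n : ℕ} {x : ℕ → A}
    (hx : word x j (m + 1) ∈ admissible X m) (hn : 0 < n) (hnm : n ≤ m + 1) :
    word x j n ∈ language X := by
  obtain ⟨t, ht, h⟩ := hx
  refine mem_language_iff.2 ⟨t, ht, n, hn, word_eq_word_iff.2 fun k hk => ?_⟩
  exact word_eq_word_iff.1 h k (by omega)

lemma approx_subset_hull {m n : ℕ} (hn : n ≤ m + 1) : approx X m ⊆ hull X n := by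
  intro x hx
  obtain ⟨t, ht, h⟩ := hx 0
  exact ⟨t, ht, PiNat.cylinder_anti x hn (word_zero_eq_iff.1 h)⟩

variable [TopologicalSpace A]

lemma IsSubshift.word_mem_admissible (hX : IsSubshift X) {x : ℕ → A} (hx : x ∈ X) (j m : ℕ) :
    word x j (m + 1) ∈ admissible X m :=
  ⟨_, hX.shift_iterate_mem hx j, by simp only [word_shift, add_zero]⟩

lemma IsSubshift.subset_approx (hX : IsSubshift X) (m : ℕ) : X ⊆ approx X m :=
  fun _ hx j => hX.word_mem_admissible hx j m

variable [DiscreteTopology A]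

lemma isSubshift_approx [Finite A] (X : Set (ℕ → A)) (m : ℕ) : IsSubshift (approx X m) where
  isCompact := by
    refine IsClosed.isCompact ?_
    have h : approx X m = ⋂ j, {x | word x j (m + 1) ∈ admissible X m} := by
      ext x; simp [approx]
    rw [h]
    refine isClosed_iInter fun j =>
      (isClopen_of_forall_mem_cylinder (n := j + (m + 1)) fun x y hxy hx => ?_).isClosed
    have h₁ : word y j (m + 1) = word x j (m + 1) :=
      word_eq_word_iff.2 fun k hk => PiNat.mem_cylinder_iff.1 hxy _ (by omega)
    rw [Set.mem_ofPred_eq, h₁]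
    exact hx
  mapsTo := fun x hx j => by
    have h := word_shift x 1 j (m + 1)
    rw [Function.iterate_one] at h
    rw [h]
    exact hx _

/-- By compactness, gluing of words gives gluing of a prefix to an entire sequence. -/
lemma IsWordGluing.isGluing (hl : IsWordGluing X l) (hX : IsSubshift X) : IsGluing X l := by
  refine IsGluing.of_pos hX.mapsTo fun n hn y hy x hx => ?_
  let K : ℕ → Set (ℕ → A) := fun N =>
    X ∩ (PiNat.cylinder y n ∩ shift^[n + l] ⁻¹' PiNat.cylinder x N)
  have hKc : ∀ N, IsClosed (PiNat.cylinder y n ∩ shift^[n + l] ⁻¹' PiNat.cylinder x N) :=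
    fun N => (isClopen_piNat_cylinder y n).isClosed.inter
      ((isClopen_piNat_cylinder x N).isClosed.preimage (continuous_shift.iterate _))
  have hXc := hX.isCompact.isClosed
  obtain ⟨z, hz⟩ := IsCompact.nonempty_iInter_of_sequence_nonempty_isCompact_isClosed K
    (fun N => by
      refine Set.inter_subset_inter_right _ (Set.inter_subset_inter_right _ ?_)
      exact Set.preimage_mono (PiNat.cylinder_anti x N.le_succ))
    (fun N => by
      obtain ⟨c, hc, h₁, h₂⟩ := hl _ (hX.word_mem_language hy 0 hn)
        _ (hX.word_mem_language hx 0 N.succ_pos)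
      rw [length_word] at h₁ h₂
      rw [length_word] at h₂
      refine ⟨c, hc, word_zero_eq_iff.1 h₁, PiNat.mem_cylinder_iff.2 fun i hi => ?_⟩
      have := word_eq_word_iff.1 h₂ i (by omega)
      rw [shift_iterate_apply, add_comm i, this, zero_add])
    (hX.isCompact.inter_right (hKc 0)) (fun N => hXc.inter (hKc N))
  rw [Set.mem_iInter] at hz
  refine ⟨z, (hz 0).1, (hz 0).2.1, funext fun i => ?_⟩
  exact PiNat.mem_cylinder_iff.1 (hz (i + 1)).2.2 i (Nat.lt_succ_self i)

/-- All finite type approximations have the gluing property of `X`, with the same gap: only the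
last, respectively first, `m` symbols matter when two words are joined in `approx X m`. -/
lemma IsWordGluing.isGluing_approx [Finite A] (hl : IsWordGluing X l) (hX : IsSubshift X) {m : ℕ}
    (hm : 1 ≤ m) : IsGluing (approx X m) l := by
  refine IsGluing.of_pos (isSubshift_approx X m).mapsTo fun n hn y hy x hx => ?_
  obtain ⟨n', hn'm, hn'n, hn'0, hn'⟩ : ∃ n', n' ≤ m ∧ n' ≤ n ∧ 0 < n' ∧ (n' = m ∨ n' = n) :=
    ⟨min m n, by omega, by omega, by omega, by omega⟩
  obtain ⟨c, hc, h₁, h₂⟩ := hl _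
    (admissible_word_mem_language (hy (n - n')) hn'0 (by omega))
    _ (admissible_word_mem_language (n := m) (hx 0) (by omega) (by omega))
  rw [length_word] at h₁ h₂
  rw [length_word] at h₂
  rw [word_eq_word_iff] at h₁ h₂
  let z : ℕ → A := fun i => if i < n then y i else if i < n + l then c (i - (n - n'))
    else x (i - (n + l))
  have hzy : ∀ i < n, z i = y i := fun i hi => if_pos hi
  have hzx : ∀ i, z (i + (n + l)) = x i := fun i => by
    simp only [z]
    rw [if_neg (by omega), if_neg (by omega), Nat.add_sub_cancel]
  have hzc : ∀ i, i < n' + l + m → z (i + (n - n')) = c i := fun i hi => by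
    by_cases hin : i + (n - n') < n
    · rw [hzy _ hin]
      have := h₁ i (by omega)
      rw [zero_add] at this
      rw [this, add_comm]
    · by_cases hil : i + (n - n') < n + l
      · simp only [z]
        rw [if_neg hin, if_pos hil, Nat.add_sub_cancel]
      · obtain ⟨k, rfl⟩ : ∃ k, i = n' + l + k := ⟨i - (n' + l), by omega⟩
        have := h₂ k (by omega)
        rw [zero_add] at this
        rw [this, ← hzx]
        congr 1
        omega
  refine ⟨z, fun j => ?_, PiNat.mem_cylinder_iff.2 hzy, funext fun i => by
    rw [shift_iterate_apply, hzx]⟩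
  by_cases hj₁ : j + (m + 1) ≤ n
  · have : word z j (m + 1) = word y j (m + 1) :=
      word_eq_word_iff.2 fun k hk => hzy _ (by omega)
    rw [this]; exact hy j
  · by_cases hj₂ : n + l ≤ j
    · have : word z j (m + 1) = word x (j - (n + l)) (m + 1) :=
        word_eq_word_iff.2 fun k hk => by rw [← hzx]; congr 1; omega
      rw [this]; exact hx _
    · -- the window meets the gap, so it lies within the translate of `c`
      have : word z j (m + 1) = word c (j - (n - n')) (m + 1) :=
        word_eq_word_iff.2 fun k hk => by
          rw [← hzc _ (by omega)]; congr 1; omega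
      rw [this]; exact hX.word_mem_admissible hc _ _

end Gluing

section Limit
variable {A : Type*} [Finite A] [TopologicalSpace A] [DiscreteTopology A] [MeasurableSpace A]
  [BorelSpace A] {X : Set (ℕ → A)} {φ : (ℕ → A) → ℝ} {C θ D : ℝ}

/-- Gibbs measures on the approximations with uniform constants accumulate only at Gibbs measures
on `X`. -/
lemma isGibbsWith_of_tendsto (hX : IsSubshift X) {μ : ℕ → ProbabilityMeasure (ℕ → A)} {P : ℕ → ℝ}
    {k : ℕ → ℕ} (hμ : ∀ m, IsGibbsWith (approx X (k m)) φ D (P m) (μ m))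
    {𝒰 : Filter ℕ} [𝒰.NeBot] (hk : Tendsto k 𝒰 atTop) {ν : ProbabilityMeasure (ℕ → A)} {Q : ℝ}
    (hν : Tendsto μ 𝒰 (𝓝 ν)) (hQ : Tendsto P 𝒰 (𝓝 Q)) : IsGibbsWith X φ D Q ν := by
  have hlim : ∀ U : Set (ℕ → A), IsClopen U → Tendsto (fun m => (μ m : Measure (ℕ → A)) U) 𝒰
      (𝓝 ((ν : Measure (ℕ → A)) U)) := fun U hU =>
    ProbabilityMeasure.tendsto_measure_of_null_frontier_of_tendsto' hν (by simp [hU.frontier_eq])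
  have hlimr : ∀ U : Set (ℕ → A), IsClopen U →
      Tendsto (fun m => (μ m : Measure (ℕ → A)).real U) 𝒰
        (𝓝 ((ν : Measure (ℕ → A)).real U)) := fun U hU =>
    (ENNReal.tendsto_toReal (measure_ne_top _ _)).comp (hlim U hU)
  have hsm : Measurable (shift : (ℕ → A) → ℕ → A) := continuous_shift.measurable
  have hshift : ∀ x n, (ν : Measure (ℕ → A)).map shift (PiNat.cylinder x n) =
      (ν : Measure (ℕ → A)) (PiNat.cylinder x n) := fun x n => by
    have hc := isClopen_piNat_cylinder x n
    rw [Measure.map_apply hsm hc.isOpen.measurableSet]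
    refine tendsto_nhds_unique ((hlim _ (hc.preimage continuous_shift)).congr fun m => ?_)
      (hlim _ hc)
    exact (hμ m).invariantOn.measurePreserving.measure_preimage
      hc.isOpen.measurableSet.nullMeasurableSet
  have hexp : ∀ x n, Tendsto (fun m => Real.exp (birkhoffSum shift φ n x - n * P m)) 𝒰
      (𝓝 (Real.exp (birkhoffSum shift φ n x - n * Q))) := fun x n =>
    (Real.continuous_exp.tendsto _).comp ((hQ.const_mul _).const_sub _)
  obtain ⟨m₀⟩ : Nonempty ℕ := inferInstance
  refine ⟨⟨⟨hsm, ?_⟩, ?_⟩, (hμ m₀).one_le, fun x hx n => ?_, fun x hx n => ?_⟩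
  · have := Measure.isProbabilityMeasure_map (μ := (ν : Measure (ℕ → A))) hsm.aemeasurable
    exact le_antisymm (measure_le_of_forall_cylinder fun x n => (hshift x n).le)
      (measure_le_of_forall_cylinder fun x n => (hshift x n).ge)
  · refine measure_eq_one_of_hull hX.isCompact.isClosed _ fun n => ?_
    refine tendsto_nhds_unique (hlim _ (isClopen_hull X n))
      (tendsto_const_nhds.congr' ?_)
    filter_upwards [hk.eventually_ge_atTop n] with m hm
    refine (le_antisymm prob_le_one ?_).symm
    rw [← (hμ m).invariantOn.carried]
    exact measure_mono (approx_subset_hull (by omega))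
  · exact le_of_tendsto_of_tendsto' ((hexp x n).const_mul _)
      (hlimr _ (isClopen_piNat_cylinder x n))
      fun m => (hμ m).le_cylinder x (hX.subset_approx _ hx) n
  · exact le_of_tendsto_of_tendsto' (hlimr _ (isClopen_piNat_cylinder x n))
      ((hexp x n).const_mul _)
      fun m => (hμ m).cylinder_le x (hX.subset_approx _ hx) n

lemma tendsto_of_isGibbsWith_approx (hX : IsSubshift X) {l : ℕ} (hl : IsGluing X l)
    (hφ : IsHolderWith φ C θ) {μ : ℕ → ProbabilityMeasure (ℕ → A)} {P : ℕ → ℝ}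
    {R : ℝ} (hP : ∀ m, |P m| ≤ R) {k : ℕ → ℕ} (hk : Tendsto k atTop atTop)
    (hμ : ∀ m, IsGibbsWith (approx X (k m)) φ D (P m) (μ m))
    {ν : ProbabilityMeasure (ℕ → A)} {D' Q : ℝ} (hν : IsGibbsWith X φ D' Q ν) :
    Tendsto μ atTop (𝓝 ν) := by
  refine tendsto_iff_ultrafilter _ _ _ |>.2 fun 𝒰 h𝒰 => ?_
  obtain ⟨ν', -, hν'⟩ := isCompact_univ.ultrafilter_le_nhds' (𝒰.map μ) univ_mem
  obtain ⟨Q', hQ'⟩ := exists_tendsto_of_abs_le 𝒰 hP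
  have h := isGibbsWith_of_tendsto hX hμ (hk.mono_left h𝒰) hν' hQ'
  rw [← hν.eq hX.isCompact.isClosed hφ hl h]
  exact hν'

end Limit
end SoficGibbs

/-! ### Left extensions and synchronising words in sofic shifts -/

namespace SoficGibbs

variable {A : Type*} {X : Set (ℕ → A)}

/-- `x` and `y` have the same extensions to the left in `X`. -/
def SamePast (X : Set (ℕ → A)) (x y : ℕ → A) : Prop :=
  ∀ u : List A, u.foldr cons x ∈ X ↔ u.foldr cons y ∈ X

lemma SamePast.symm {x y : ℕ → A} (h : SamePast X x y) : SamePast X y x := fun u => (h u).symm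

lemma SamePast.cons {x y : ℕ → A} (h : SamePast X x y) (a : A) :
    SamePast X (cons a x) (cons a y) := fun u => by
  simpa using h (u ++ [a])

lemma SamePast.cons_mem_iff {x y : ℕ → A} (h : SamePast X x y) (a : A) :
    SoficGibbs.cons a x ∈ X ↔ SoficGibbs.cons a y ∈ X := h [a]

lemma cons_mem_cylinder {x y : ℕ → A} {n : ℕ} (h : x ∈ PiNat.cylinder y n) (a : A) :
    cons a x ∈ PiNat.cylinder (cons a y) (n + 1) := by
  rw [PiNat.mem_cylinder_iff] at h ⊢
  intro i hi
  cases i with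
  | zero => rfl
  | succ i => exact h i (by omega)

lemma word_foldr_cons (u : List A) (x : ℕ → A) (n : ℕ) :
    word (u.foldr cons x) 0 (u.length + n) = u ++ word x 0 n := by
  induction u with
  | nil => simp
  | cons a u ih =>
    rw [List.cons_append, ← ih, List.foldr_cons, List.length_cons]
    rw [show u.length + 1 + n = (u.length + n) + 1 by ring]
    simp only [word, List.ofFn_succ, zero_add]
    rfl

/-- A sofic subshift has a synchronising word: a prefix that determines the left extensions of a
point. Any word with a minimal follower set is one. -/
lemma IsSofic.exists_synchronising [TopologicalSpace A] [T2Space A] (hs : IsSofic X)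
    (hX : IsSubshift X) (hne : X.Nonempty) : ∃ y₀ ∈ X, ∃ q, ∀ x ∈ X, ∀ x' ∈ X,
      x ∈ PiNat.cylinder y₀ q → x' ∈ PiNat.cylinder y₀ q → SamePast X x x' := by
  obtain ⟨x₀, hx₀⟩ := hne
  have hlang : (language X).Nonempty := ⟨_, hX.word_mem_language hx₀ 0 one_pos⟩
  obtain ⟨F, ⟨⟨a, ha, rfl⟩, hmin⟩⟩ := hs.exists_minimal (hlang.image (followers X))
  obtain ⟨y₀, hy₀, q, hq, rfl⟩ := mem_language_iff.1 ha
  refine ⟨y₀, hy₀, q, ?_⟩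
  have key : ∀ x ∈ X, ∀ x' ∈ X, x ∈ PiNat.cylinder y₀ q → x' ∈ PiNat.cylinder y₀ q →
      ∀ u : List A, u.foldr cons x ∈ X → u.foldr cons x' ∈ X := by
    intro x hx x' hx' hxy hx'y u hu
    rw [← word_zero_eq_iff] at hxy hx'y
    have huq : u ++ word y₀ 0 q ∈ language X := by
      rw [← hxy, ← word_foldr_cons]
      exact hX.word_mem_language hu 0 (by omega)
    -- by minimality, `u` to the left does not restrict the followers
    have hsub : followers X (u ++ word y₀ 0 q) ⊆ followers X (word y₀ 0 q) := by
      rintro b ⟨hb, hab⟩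
      refine ⟨hb, ?_⟩
      obtain ⟨t, ht, n, hn, htn⟩ := mem_language_iff.1 hab
      have hlen := congrArg List.length htn
      rw [length_word, List.length_append, List.length_append, length_word] at hlen
      have h₁ : word t 0 n = word t 0 u.length ++ word t (0 + u.length) (q + b.length) := by
        rw [word_append]; congr 1; omega
      rw [htn, List.append_assoc] at h₁
      rw [List.append_inj_right h₁ (by simp)]
      exact hX.word_mem_language ht _ (by omega)
    have heq := hmin ⟨_, huq, rfl⟩ hsub
    refine mem_of_forall_prefix hX.isCompact.isClosed fun n => ?_
    have hb : word x' q (n + 1) ∈ followers X (word y₀ 0 q) := by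
      refine ⟨hX.word_mem_language hx' q n.succ_pos, ?_⟩
      rw [← hx'y]
      have := word_append x' 0 q (n + 1)
      rw [zero_add] at this
      rw [this]
      exact hX.word_mem_language hx' 0 (by omega)
    have h₂ := (heq hb).2
    have h₃ := word_append x' 0 q (n + 1)
    rw [zero_add] at h₃
    rw [List.append_assoc, ← hx'y, h₃, ← word_foldr_cons] at h₂
    obtain ⟨t, ht, k, hk, htk⟩ := mem_language_iff.1 h₂
    have hlen := congrArg List.length htk
    rw [length_word, length_word] at hlen
    rw [hlen] at htk
    exact ⟨t, ht, PiNat.cylinder_anti _ (by omega) (word_zero_eq_iff.1 htk)⟩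
  exact fun x hx x' hx' h h' u => ⟨key x hx x' hx' h h' u, key x' hx' x hx h' h u⟩

variable {θ : ℝ}

/-- `r` oscillates by at most `M` on `X`, and is Hölder with constant `H` between points with the
same left extensions. -/
structure HasOsc (X : Set (ℕ → A)) (θ : ℝ) (r : (ℕ → A) → ℝ) (M H : ℝ) : Prop where
  range : ∃ c, ∀ x ∈ X, c ≤ r x ∧ r x ≤ c + M
  holder : ∀ x ∈ X, ∀ y ∈ X, SamePast X x y → ∀ n, x ∈ PiNat.cylinder y n →
    |r x - r y| ≤ H * θ ^ n

lemma HasOsc.abs_sub_le {r : (ℕ → A) → ℝ} {M H : ℝ} (hr : HasOsc X θ r M H) {x y : ℕ → A}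
    (hx : x ∈ X) (hy : y ∈ X) : |r x - r y| ≤ M := by
  obtain ⟨c, hc⟩ := hr.range
  have h₁ := hc x hx
  have h₂ := hc y hy
  rw [abs_le]
  constructor <;> linarith [h₁.1, h₁.2, h₂.1, h₂.2]

lemma HasOsc.mono {r : (ℕ → A) → ℝ} {M H M' H' : ℝ} (hr : HasOsc X θ r M H) (hθ : 0 < θ)
    (hM : M ≤ M') (hH : H ≤ H') : HasOsc X θ r M' H' where
  range := by
    obtain ⟨c, hc⟩ := hr.range
    exact ⟨c, fun x hx => ⟨(hc x hx).1, by linarith [(hc x hx).2]⟩⟩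
  holder x hx y hy hxy n hn := (hr.holder x hx y hy hxy n hn).trans (by
    have := pow_pos hθ n
    gcongr)

lemma exists_range_of_sub_le {r : (ℕ → A) → ℝ} {M : ℝ} (hne : X.Nonempty)
    (h : ∀ x ∈ X, ∀ y ∈ X, r x - r y ≤ M) : ∃ c, ∀ x ∈ X, c ≤ r x ∧ r x ≤ c + M := by
  obtain ⟨x₀, hx₀⟩ := hne
  have hb : BddBelow (r '' X) := by
    refine ⟨r x₀ - M, ?_⟩
    rintro _ ⟨y, hy, rfl⟩
    linarith [h x₀ hx₀ y hy]
  refine ⟨sInf (r '' X), fun x hx => ⟨csInf_le hb ⟨x, hx, rfl⟩, ?_⟩⟩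
  have : r x - M ≤ sInf (r '' X) := by
    refine le_csInf ⟨_, x₀, hx₀, rfl⟩ ?_
    rintro _ ⟨y, hy, rfl⟩
    linarith [h x hx y hy]
  linarith

lemma abs_sub_le_of_le_exp_mul {a b t s : ℝ} (ha : 0 ≤ a) (hb : 0 ≤ b) (ht : 0 ≤ t) (hts : t ≤ s)
    (hab : a ≤ Real.exp t * b) (hba : b ≤ Real.exp t * a) :
    |a - b| ≤ t * Real.exp s * (a + b) := by
  have h₁ : Real.exp t - 1 ≤ t * Real.exp s := by
    have h₂ := Real.add_one_le_exp (-t)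
    have h₃ : Real.exp t * Real.exp (-t) = 1 := by rw [← Real.exp_add]; simp
    have h₄ : t * Real.exp t ≤ t * Real.exp s := by gcongr
    nlinarith [Real.exp_pos t]
  have h₂ : 0 ≤ t * Real.exp s := by positivity
  rw [abs_le]
  constructor <;> nlinarith

variable [Fintype A] {φ : (ℕ → A) → ℝ} {C P K : ℝ} {l : ℕ} {h : (ℕ → A) → ℝ}

lemma partition_le_of_samePast (hφ : IsHolderWith φ C θ) (k : ℕ) : ∀ {x y : ℕ → A} {n : ℕ},
    SamePast X x y → x ∈ PiNat.cylinder y n →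
    partition X φ k x ≤ Real.exp (C / (1 - θ) * θ ^ n) * partition X φ k y := by
  have hV : 0 ≤ C / (1 - θ) := div_nonneg hφ.nonneg (sub_pos.2 hφ.lt_one).le
  have hw := isWeightOn_expWeight X φ
  induction k with
  | zero =>
    intro x y n _ _
    have := pow_pos hφ.pos n
    simpa [partition] using mul_nonneg hV this.le
  | succ k ih =>
    intro x y n hxy hc
    rw [partition, partition, transfer_pow_succ_apply, transfer_pow_succ_apply, Finset.mul_sum]
    refine Finset.sum_le_sum fun a _ => ?_
    by_cases ha : cons a x ∈ X
    · have hb : cons a y ∈ X := (hxy.cons_mem_iff a).1 ha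
      have h₁ := ih (hxy.cons a) (cons_mem_cylinder hc a)
      have h₂ := hφ.abs_sub_le n (cons a x) (cons a y) fun i hi =>
        PiNat.mem_cylinder_iff.1 (cons_mem_cylinder hc a) i (by omega)
      have h₃ := partition_nonneg (Y := X) φ k hb
      rw [expWeight, Set.indicator_of_mem ha, Set.indicator_of_mem hb]
      calc _ ≤ Real.exp (φ (cons a y) + C * θ ^ n) *
            (Real.exp (C / (1 - θ) * θ ^ (n + 1)) * partition X φ k (cons a y)) := by
            refine mul_le_mul (Real.exp_le_exp.2 (by linarith [le_of_abs_le h₂])) h₁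
              (partition_nonneg φ k ha) (Real.exp_pos _).le
        _ = Real.exp (φ (cons a y)) * (Real.exp (C * θ ^ n + C / (1 - θ) * θ ^ (n + 1)) *
            partition X φ k (cons a y)) := by rw [Real.exp_add, Real.exp_add]; ring
        _ = Real.exp (φ (cons a y)) * (Real.exp (C / (1 - θ) * θ ^ n) *
            partition X φ k (cons a y)) := by
            congr 3
            have := (sub_pos.2 hφ.lt_one).ne'
            field_simp
            ring
        _ = _ := by rw [partition, expWeight]; ring
    · simp [hw.eq_zero _ ha, hw.eq_zero _ fun hb => ha ((hxy.cons_mem_iff a).2 hb)]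

/-- `h` is log-Hölder on `X`, with constant `V`, between points with the same left extensions. -/
def IsLogHolder (X : Set (ℕ → A)) (V θ : ℝ) (h : (ℕ → A) → ℝ) : Prop :=
  ∀ x ∈ X, ∀ y ∈ X, SamePast X x y → ∀ n, x ∈ PiNat.cylinder y n →
    h x ≤ Real.exp (V * θ ^ n) * h y

lemma normWeight_le_of_samePast (hφ : IsHolderWith φ C θ) (hh : IsEigenfunction X φ P K h)
    {V : ℝ} (hCV : C ≤ V) (hV : IsLogHolder X V θ h)
    {x y : ℕ → A} (hx : x ∈ X) (hy : y ∈ X) {n : ℕ} (hxy : SamePast X x y)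
    (hc : x ∈ PiNat.cylinder y n) (a : A) :
    normWeight X φ P h (cons a x) ≤
      Real.exp (3 * V * θ ^ n) * normWeight X φ P h (cons a y) := by
  by_cases ha : cons a x ∈ X
  · have hb : cons a y ∈ X := (hxy.cons_mem_iff a).1 ha
    have h₁ := hφ.abs_sub_le n (cons a x) (cons a y) fun i hi =>
      PiNat.mem_cylinder_iff.1 (cons_mem_cylinder hc a) i (by omega)
    have h₂ := hV _ ha _ hb (hxy.cons a) _ (cons_mem_cylinder hc a)
    have h₃ := hV _ hy _ hx hxy.symm _ ((PiNat.mem_cylinder_comm _ _ _).1 hc)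
    have hθ := pow_pos hφ.pos n
    have hx0 := hh.pos hx
    have hy0 := hh.pos hy
    have hb0 := hh.pos hb
    have hC := hφ.nonneg
    rw [normWeight, Set.indicator_of_mem ha, Set.indicator_of_mem hb, shift_cons, shift_cons,
      ← mul_div_assoc, div_le_div_iff₀ hx0 hy0]
    calc _ ≤ Real.exp (φ (cons a y) - P + V * θ ^ n) *
          (Real.exp (V * θ ^ n) * h (cons a y)) * (Real.exp (V * θ ^ n) * h x) := by
          have h₄ : C * θ ^ n ≤ V * θ ^ n := by gcongr
          have h₅ : h (cons a x) ≤ Real.exp (V * θ ^ n) * h (cons a y) := by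
            refine h₂.trans ?_
            have h₆ : V * θ ^ (n + 1) ≤ V * θ ^ n :=
              mul_le_mul_of_nonneg_left
                (pow_le_pow_of_le_one hφ.pos.le hφ.lt_one.le n.le_succ) (hC.trans hCV)
            gcongr
          have h₇ := hh.pos ha
          have h₈ : φ (cons a x) - P ≤ φ (cons a y) - P + V * θ ^ n := by
            linarith [le_of_abs_le h₁]
          gcongr
      _ = Real.exp (V * θ ^ n + V * θ ^ n + V * θ ^ n) *
          (Real.exp (φ (cons a y) - P) * h (cons a y)) * h x := by
          simp only [Real.exp_add]; ring
      _ = _ := by rw [show 3 * V * θ ^ n = V * θ ^ n + V * θ ^ n + V * θ ^ n by ring]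
  · simp [normWeight, Set.indicator_of_notMem ha,
      Set.indicator_of_notMem fun hb => ha ((hxy.cons_mem_iff a).2 hb)]

end SoficGibbs

/-! ### Contraction of the normalised transfer operator -/

namespace SoficGibbs

variable {A : Type*} {X : Set (ℕ → A)} [Fintype A] {φ : (ℕ → A) → ℝ} {C θ P K V : ℝ} {l : ℕ}
  {h : (ℕ → A) → ℝ}

/-- The constant in the Lasota–Yorke inequality for the normalised transfer operator. -/
noncomputable def lasotaYorkeConst (V : ℝ) : ℝ := 6 * V * Real.exp (3 * V)

lemma sum_normWeight (hh : IsEigenfunction X φ P K h) {x : ℕ → A} (hx : x ∈ X) :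
    ∑ a, normWeight X φ P h (cons a x) = 1 := by
  simpa [transfer_apply] using hh.transfer_one hx

lemma IsEigenfunction.transfer_pow_range (hh : IsEigenfunction X φ P K h) (hX : Set.MapsTo shift X X)
    {r : (ℕ → A) → ℝ} {M : ℝ} (hr : ∃ c, ∀ x ∈ X, c ≤ r x ∧ r x ≤ c + M) (n : ℕ) :
    ∃ c, ∀ x ∈ X, c ≤ (transfer (normWeight X φ P h) ^ n) r x ∧
      (transfer (normWeight X φ P h) ^ n) r x ≤ c + M := by
  obtain ⟨c, hc⟩ := hr
  have hw := hh.isWeightOn hX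
  refine ⟨c, fun x hx => ⟨?_, ?_⟩⟩
  · rw [← hh.transfer_pow_const hX c n hx]
    exact hw.transfer_pow_mono (fun y hy => (hc y hy).1) n x hx
  · conv_rhs => rw [← hh.transfer_pow_const hX (c + M) n hx]
    exact hw.transfer_pow_mono (fun y hy => (hc y hy).2) n x hx

/-- One step of the Lasota–Yorke inequality: the Hölder constant contracts by `θ`, up to a multiple
of the oscillation. -/
lemma HasOsc.transfer (hφ : IsHolderWith φ C θ) (hh : IsEigenfunction X φ P K h)
    (hX : Set.MapsTo shift X X) (hCV : C ≤ V) (hV : IsLogHolder X V θ h)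
    {r : (ℕ → A) → ℝ} {M H : ℝ} (hr : HasOsc X θ r M H) :
    HasOsc X θ (transfer (normWeight X φ P h) r) M (θ * H + lasotaYorkeConst V * M) := by
  have hw := hh.isWeightOn hX
  have hV0 : 0 ≤ V := hφ.nonneg.trans hCV
  refine ⟨by simpa using hh.transfer_pow_range hX hr.range 1, fun x hx y hy hxy n hc => ?_⟩
  set G := normWeight X φ P h
  have hθn : 0 < θ ^ n := pow_pos hφ.pos n
  have hθn1 : θ ^ n ≤ 1 := pow_le_one₀ hφ.pos.le hφ.lt_one.le
  have hsx : ∑ a, G (cons a x) = 1 := sum_normWeight hh hx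
  have hsy : ∑ a, G (cons a y) = 1 := sum_normWeight hh hy
  have hdecomp : SoficGibbs.transfer G r x - SoficGibbs.transfer G r y =
      ∑ a, ((G (cons a x) - G (cons a y)) * (r (cons a x) - r x) +
        G (cons a y) * (r (cons a x) - r (cons a y))) := by
    have h₁ : ∑ a, ((G (cons a x) - G (cons a y)) * (r (cons a x) - r x) +
        G (cons a y) * (r (cons a x) - r (cons a y))) =
        ∑ a, (G (cons a x) * r (cons a x) - G (cons a y) * r (cons a y) -
          (G (cons a x) * r x - G (cons a y) * r x)) :=
      Finset.sum_congr rfl fun a _ => by ring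
    rw [h₁, Finset.sum_sub_distrib, Finset.sum_sub_distrib, Finset.sum_sub_distrib,
      ← Finset.sum_mul, ← Finset.sum_mul, hsx, hsy, sub_self, sub_zero, transfer_apply,
      transfer_apply]
  have hterm : ∀ a, |(G (cons a x) - G (cons a y)) * (r (cons a x) - r x) +
        G (cons a y) * (r (cons a x) - r (cons a y))| ≤
      3 * V * θ ^ n * Real.exp (3 * V) * (G (cons a x) + G (cons a y)) * M +
        G (cons a y) * (H * θ ^ (n + 1)) := fun a => by
    by_cases ha : cons a x ∈ X
    · have hb : cons a y ∈ X := (hxy.cons_mem_iff a).1 ha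
      have h₁ : |G (cons a x) - G (cons a y)| ≤
          3 * V * θ ^ n * Real.exp (3 * V) * (G (cons a x) + G (cons a y)) :=
        abs_sub_le_of_le_exp_mul (hw.nonneg _) (hw.nonneg _) (by positivity) (by nlinarith)
          (normWeight_le_of_samePast hφ hh hCV hV hx hy hxy hc a)
          (normWeight_le_of_samePast hφ hh hCV hV hy hx hxy.symm
            ((PiNat.mem_cylinder_comm _ _ _).1 hc) a)
      have h₂ := hr.abs_sub_le ha hx
      have h₃ := hr.holder _ ha _ hb (hxy.cons a) _ (cons_mem_cylinder hc a)
      have h₄ : 0 ≤ G (cons a y) := hw.nonneg _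
      refine (abs_add_le _ _).trans ?_
      rw [abs_mul, abs_mul, abs_of_nonneg h₄]
      gcongr
      exact (abs_nonneg _).trans h₁
    · have hb : cons a y ∉ X := fun hb => ha ((hxy.cons_mem_iff a).2 hb)
      have h₁ : G (cons a x) = 0 := hw.eq_zero _ ha
      have h₂ : G (cons a y) = 0 := hw.eq_zero _ hb
      simp [h₁, h₂]
  rw [hdecomp]
  refine (Finset.abs_sum_le_sum_abs _ _).trans ((Finset.sum_le_sum fun a _ => hterm a).trans ?_)
  rw [Finset.sum_add_distrib, ← Finset.sum_mul, ← Finset.sum_mul, ← Finset.mul_sum,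
    Finset.sum_add_distrib, hsx, hsy, lasotaYorkeConst, pow_succ]
  exact le_of_eq (by ring)

/-- The Hölder constant, relative to the oscillation, after many steps. -/
noncomputable def holderBound (V θ : ℝ) : ℝ := lasotaYorkeConst V / (1 - θ)

lemma HasOsc.transfer_pow (hφ : IsHolderWith φ C θ) (hh : IsEigenfunction X φ P K h)
    (hX : Set.MapsTo shift X X) (hCV : C ≤ V) (hV : IsLogHolder X V θ h)
    {r : (ℕ → A) → ℝ} {M H : ℝ} (hM : 0 ≤ M) (hr : HasOsc X θ r M H) (n : ℕ) :
    HasOsc X θ ((SoficGibbs.transfer (normWeight X φ P h) ^ n) r) M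
      (θ ^ n * H + holderBound V θ * M) := by
  have h1 := sub_pos.2 hφ.lt_one
  have hV0 : 0 ≤ V := hφ.nonneg.trans hCV
  induction n with
  | zero =>
    refine hr.mono hφ.pos le_rfl ?_
    have : 0 ≤ holderBound V θ := by unfold holderBound lasotaYorkeConst; positivity
    simpa using mul_nonneg this hM
  | succ n ih =>
    rw [pow_succ', Module.End.mul_apply]
    refine (HasOsc.transfer hφ hh hX hCV hV ih).mono hφ.pos le_rfl (le_of_eq ?_)
    unfold holderBound
    field_simp
    ring

/-- The Doeblin step: two points have preimages, of weight bounded below, that both start with a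
long prefix of a synchronising sequence. There `r` nearly agrees, which makes the oscillation
contract. -/
lemma HasOsc.transfer_pow_sub_le (hh : IsEigenfunction X φ P K h)
    (hX : Set.MapsTo shift X X) (hl : IsGluing X l) {y₀ : ℕ → A} (hy₀ : y₀ ∈ X) {p : ℕ}
    (hsync : ∀ x ∈ X, ∀ x' ∈ X, x ∈ PiNat.cylinder y₀ p → x' ∈ PiNat.cylinder y₀ p →
      SamePast X x x')
    {r : (ℕ → A) → ℝ} {M H ε : ℝ} (hr : HasOsc X θ r M H)
    (hε : ∀ z ∈ X, ε ≤ weightProd (normWeight X φ P h) (p + l) z)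
    {x y : ℕ → A} (hx : x ∈ X) (hy : y ∈ X) (hε0 : 0 ≤ ε) :
    (SoficGibbs.transfer (normWeight X φ P h) ^ (p + l)) r x -
      (SoficGibbs.transfer (normWeight X φ P h) ^ (p + l)) r y ≤
        (1 - ε) * M + ε * (H * θ ^ p) := by
  have hw := hh.isWeightOn hX
  obtain ⟨c, hc⟩ := hr.range
  obtain ⟨z, hz, hzy, rfl⟩ := hl p y₀ hy₀ x hx
  obtain ⟨z', hz', hzy', rfl⟩ := hl p y₀ hy₀ y hy
  have hzz' : |r z - r z'| ≤ H * θ ^ p := by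
    refine hr.holder z hz z' hz' (hsync z hz z' hz' hzy hzy') p ?_
    rw [PiNat.mem_cylinder_iff_eq] at *
    rw [hzy, hzy']
  have hconst : ∀ d : ℝ, ∀ x ∈ X,
      (SoficGibbs.transfer (normWeight X φ P h) ^ (p + l)) (fun _ => d) x = d := fun d x hx =>
    hh.transfer_pow_const hX d _ hx
  have h₁ := hw.weightProd_mul_le hX (f := (fun _ => c + M) - r)
    (fun t ht => sub_nonneg.2 (hc t ht).2) (p + l) hz
  have h₂ := hw.weightProd_mul_le hX (f := r - fun _ => c)
    (fun t ht => sub_nonneg.2 (hc t ht).1) (p + l) hz'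
  rw [Pi.sub_apply, map_sub, Pi.sub_apply, hconst _ _ hx] at h₁
  rw [Pi.sub_apply, map_sub, Pi.sub_apply, hconst _ _ hy] at h₂
  have h₃ := mul_le_mul_of_nonneg_right (hε z hz) (sub_nonneg.2 (hc z hz).2)
  have h₄ := mul_le_mul_of_nonneg_right (hε z' hz') (sub_nonneg.2 (hc z' hz').1)
  have h₅ := mul_le_mul_of_nonneg_left (le_of_abs_le hzz') hε0
  linarith

/-- The normalised transfer operator contracts the oscillation exponentially. -/
lemma exists_contraction (hφ : IsHolderWith φ C θ) (hh : IsEigenfunction X φ P K h)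
    (hX : Set.MapsTo shift X X) (hCV : C ≤ V) (hV : IsLogHolder X V θ h)
    (hl : IsGluing X l) {y₀ : ℕ → A} (hy₀ : y₀ ∈ X) {q : ℕ}
    (hsync : ∀ x ∈ X, ∀ x' ∈ X, x ∈ PiNat.cylinder y₀ q → x' ∈ PiNat.cylinder y₀ q →
      SamePast X x x') :
    ∃ ρ : ℝ, 0 < ρ ∧ ρ < 1 ∧ ∃ N : ℕ, 0 < N ∧ ∃ Γ : ℝ, 1 ≤ Γ ∧
      ∀ r t, 0 ≤ t → HasOsc X θ r t (Γ * t) → ∀ s : ℕ,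
        ∃ c, ∀ x ∈ X, c ≤ (SoficGibbs.transfer (normWeight X φ P h) ^ s) r x ∧
          (SoficGibbs.transfer (normWeight X φ P h) ^ s) r x ≤ c + ρ ^ (s / N) * t := by
  have h1 := sub_pos.2 hφ.lt_one
  have hV0 : 0 ≤ V := hφ.nonneg.trans hCV
  set D := holderBound V θ with hD
  have hD0 : 0 ≤ D := by rw [hD]; unfold holderBound lasotaYorkeConst; positivity
  set Γ : ℝ := 2 * (D + 1) with hΓ
  have hΓ2 : 2 ≤ Γ := by linarith
  -- `p` is so large that Hölder functions nearly agree on the synchronising cylinder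
  obtain ⟨p₀, hp₀⟩ := exists_pow_lt_of_lt_one (show 0 < 1 / (2 * Γ) by positivity) hφ.lt_one
  obtain ⟨p, hpq, hpp, hp0⟩ : ∃ p, q ≤ p ∧ p₀ ≤ p ∧ 0 < p :=
    ⟨max q p₀ + 1, by omega, by omega, by omega⟩
  have hp : θ ^ p * Γ ≤ 1 / 2 := by
    have h₁ := (pow_le_pow_of_le_one hφ.pos.le hφ.lt_one.le hpp).trans hp₀.le
    rw [le_div_iff₀ (by positivity)] at h₁
    linarith
  have hsync' : ∀ x ∈ X, ∀ x' ∈ X, x ∈ PiNat.cylinder y₀ p → x' ∈ PiNat.cylinder y₀ p →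
      SamePast X x x' := fun x hx x' hx' hxy hxy' =>
    hsync x hx x' hx' (PiNat.cylinder_anti _ hpq hxy) (PiNat.cylinder_anti _ hpq hxy')
  set N := p + l with hN
  have hK := one_pos.trans_le hh.one_le
  set ε : ℝ := (K ^ 2)⁻¹ * Real.exp (-(N * (C + |P|))) with hεd
  have hε0 : 0 < ε := by positivity
  have hε1 : ε ≤ 1 := by
    refine mul_le_one₀ (inv_le_one_of_one_le₀ (one_le_pow₀ hh.one_le)) (Real.exp_pos _).le ?_
    rw [Real.exp_le_one_iff, neg_nonpos]
    exact mul_nonneg (Nat.cast_nonneg _) (add_nonneg hφ.nonneg (abs_nonneg _))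
  have hε : ∀ z ∈ X, ε ≤ weightProd (normWeight X φ P h) N z := fun z hz => by
    refine le_trans ?_ (hh.le_weightProd hX N hz)
    rw [hεd]
    gcongr
    have h₁ := neg_le_of_abs_le (hφ.abs_birkhoffSum_le N z)
    have h₂ : (N : ℝ) * P ≤ N * |P| := by gcongr; exact le_abs_self P
    linarith
  set ρ : ℝ := max (1 - ε / 2) (3 / 4) with hρ
  have hρ0 : 0 < ρ := lt_max_of_lt_right (by norm_num)
  have hρ1 : ρ < 1 := max_lt (by linarith) (by norm_num)
  have hne : X.Nonempty := ⟨y₀, hy₀⟩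
  have hstep : ∀ r t, 0 ≤ t → HasOsc X θ r t (Γ * t) →
      HasOsc X θ ((SoficGibbs.transfer (normWeight X φ P h) ^ N) r) (ρ * t) (Γ * (ρ * t)) := by
    intro r t ht hr
    have h₁ := hr.transfer_pow hφ hh hX hCV hV ht N
    refine ⟨exists_range_of_sub_le hne fun x hx y hy => ?_, fun x hx y hy hxy n hn => ?_⟩
    · refine (hr.transfer_pow_sub_le hh hX hl hy₀ hsync' hε hx hy hε0.le).trans ?_
      have h₂ : Γ * t * θ ^ p ≤ 1 / 2 * t := by nlinarith
      have h₃ : (1 - ε / 2) * t ≤ ρ * t := by gcongr; exact le_max_left _ _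
      nlinarith
    · refine (h₁.holder x hx y hy hxy n hn).trans ?_
      have hθn := pow_pos hφ.pos n
      have h₂ : θ ^ N ≤ θ ^ p :=
        pow_le_pow_of_le_one hφ.pos.le hφ.lt_one.le (Nat.le_add_right _ _)
      have h₃ : 3 / 4 * t ≤ ρ * t := by gcongr; exact le_max_right _ _
      have h₄ : θ ^ N * (Γ * t) ≤ 1 / 2 * t := by
        have h₅ : θ ^ N * (Γ * t) ≤ θ ^ p * (Γ * t) := by gcongr
        nlinarith
      have h₆ : Γ * (3 / 4 * t) ≤ Γ * (ρ * t) := by gcongr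
      have h₇ : θ ^ N * (Γ * t) + D * t ≤ Γ * (ρ * t) := by
        refine le_trans ?_ h₆
        have h₈ : D * t = Γ / 2 * t - t := by rw [hΓ]; ring
        nlinarith
      gcongr
  have hiter : ∀ (j : ℕ) r t, 0 ≤ t → HasOsc X θ r t (Γ * t) →
      HasOsc X θ ((SoficGibbs.transfer (normWeight X φ P h) ^ (N * j)) r) (ρ ^ j * t)
        (Γ * (ρ ^ j * t)) := by
    intro j r t ht hr
    induction j with
    | zero => simpa using hr
    | succ j ih =>
      have h₁ := hstep _ _ (by positivity) ih
      rw [← Module.End.mul_apply, ← pow_add] at h₁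
      rw [pow_succ', mul_assoc, Nat.mul_succ, add_comm]
      exact h₁
  refine ⟨ρ, hρ0, hρ1, N, by omega, Γ, by linarith, fun r t ht hr s => ?_⟩
  have h₁ := hh.transfer_pow_range hX (hiter (s / N) r t ht hr).range (s % N)
  rwa [← Module.End.mul_apply, ← pow_add, Nat.mod_add_div] at h₁

end SoficGibbs

/-! ### Decay of correlations -/

namespace SoficGibbs

variable {A : Type*}

/-- An exponentially small quantity is eventually smaller than a stretched exponential one. -/
lemma exists_forall_mul_pow_div_le (c : ℝ) {ρ : ℝ} (hρ0 : 0 < ρ) (hρ1 : ρ < 1) {N : ℕ}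
    (hN : 0 < N) : ∃ s₀ : ℕ, ∀ s : ℕ, s₀ ≤ s →
      c * ρ ^ (s / N) ≤ (1 / 2 : ℝ) ^ Real.sqrt s := by
  have hlog : Real.log ρ < 0 := Real.log_neg hρ0 hρ1
  have hN' : (0 : ℝ) < N := by exact_mod_cast hN
  set κ : ℝ := -Real.log ρ / N with hκ
  have hκ0 : 0 < κ := div_pos (neg_pos.2 hlog) hN'
  have hlim : Tendsto (fun s : ℕ => Real.sqrt s * (κ * Real.sqrt s - Real.log 2)) atTop atTop := by
    have h₁ : Tendsto (fun s : ℕ => Real.sqrt s) atTop atTop :=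
      Real.tendsto_sqrt_atTop.comp tendsto_natCast_atTop_atTop
    exact h₁.atTop_mul_atTop₀ (tendsto_atTop_add_const_right _ _ (h₁.const_mul_atTop hκ0))
  obtain ⟨s₀, hs₀⟩ := eventually_atTop.1
    (hlim.eventually_ge_atTop (Real.log (|c| + 1) - Real.log ρ))
  refine ⟨s₀, fun s hs => ?_⟩
  have h₁ := hs₀ s hs
  have h₂ : Real.sqrt s * Real.sqrt s = s := Real.mul_self_sqrt (Nat.cast_nonneg s)
  have h₃ : (s : ℝ) / N ≤ ((s / N : ℕ) : ℝ) + 1 := by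
    rw [div_le_iff₀ hN']
    have h₄ := Nat.lt_div_mul_add (a := s) hN
    have h₅ : s ≤ (s / N + 1) * N := by rw [add_mul, one_mul]; exact h₄.le
    exact_mod_cast h₅
  have hc : (0 : ℝ) < |c| + 1 := by positivity
  have h₆ : κ * s = -Real.log ρ * (s / N) := by rw [hκ]; ring
  calc c * ρ ^ (s / N) ≤ (|c| + 1) * ρ ^ (s / N) := by
        gcongr
        linarith [le_abs_self c]
    _ = Real.exp (Real.log (|c| + 1) + (s / N : ℕ) * Real.log ρ) := by
        rw [Real.exp_add, Real.exp_log hc, mul_comm _ (Real.log ρ), Real.exp_mul,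
          Real.exp_log hρ0, Real.rpow_natCast]
    _ ≤ Real.exp (Real.log (1 / 2) * Real.sqrt s) := by
        refine Real.exp_le_exp.2 ?_
        rw [one_div, Real.log_inv]
        nlinarith
    _ = _ := by rw [Real.rpow_def_of_pos (by norm_num)]

variable {X : Set (ℕ → A)} {θ : ℝ}

lemma hasOsc_indicator_cylinder (hθ0 : 0 < θ) (hθ1 : θ < 1) (x : ℕ → A) (n : ℕ) {Γ : ℝ}
    (hΓ : 1 ≤ Γ) : HasOsc X θ ((PiNat.cylinder x n).indicator 1) (θ ^ n)⁻¹ (Γ * (θ ^ n)⁻¹) := by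
  have hn := pow_pos hθ0 n
  have h1 : 1 ≤ (θ ^ n)⁻¹ := one_le_inv₀ hn |>.2 (pow_le_one₀ hθ0.le hθ1.le)
  have hind : ∀ y, 0 ≤ (PiNat.cylinder (E := fun _ => A) x n).indicator (1 : (ℕ → A) → ℝ) y ∧
      (PiNat.cylinder (E := fun _ => A) x n).indicator (1 : (ℕ → A) → ℝ) y ≤ 1 := fun y => by
    by_cases hy : y ∈ PiNat.cylinder (E := fun _ => A) x n <;> simp [hy]
  refine ⟨⟨0, fun y _ => ⟨(hind y).1, by linarith [(hind y).2]⟩⟩, fun y _ z _ _ k hk => ?_⟩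
  have hkpos := pow_pos hθ0 k
  rcases le_total n k with hnk | hkn
  · have h₂ : y ∈ PiNat.cylinder x n ↔ z ∈ PiNat.cylinder x n := by
      have h₃ := PiNat.mem_cylinder_iff_eq.1 (PiNat.cylinder_anti z hnk hk)
      rw [PiNat.mem_cylinder_iff_eq, PiNat.mem_cylinder_iff_eq, h₃]
    have h₄ : (PiNat.cylinder x n).indicator (1 : (ℕ → A) → ℝ) y =
        (PiNat.cylinder x n).indicator (1 : (ℕ → A) → ℝ) z := by
      by_cases hy : y ∈ PiNat.cylinder x n
      · simp [hy, h₂.1 hy]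
      · simp [hy, mt h₂.2 hy]
    rw [h₄, sub_self, abs_zero]
    positivity
  · have h₂ : θ ^ n ≤ θ ^ k := pow_le_pow_of_le_one hθ0.le hθ1.le hkn
    have h₃ : 1 ≤ Γ * (θ ^ n)⁻¹ * θ ^ k := by
      have h₄ : 1 ≤ (θ ^ n)⁻¹ * θ ^ k := by
        rw [inv_mul_eq_div, one_le_div hn]; exact h₂
      rw [mul_assoc]
      exact one_le_mul_of_one_le_of_one_le hΓ h₄
    refine le_trans ?_ h₃
    rw [abs_le]
    constructor <;> linarith [(hind y).1, (hind y).2, (hind z).1, (hind z).2]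

variable [Fintype A] {φ : (ℕ → A) → ℝ} {C P K V : ℝ} {l : ℕ}
  {h : (ℕ → A) → ℝ} {L : ((ℕ → A) → ℝ) →ₗ[ℝ] ℝ}

/-- Decay of correlations for the stationary functional: an observable `f` may be replaced by its
mean as soon as the transfer operator has made it nearly constant. -/
lemma IsStationary.abs_sub_le (hL : IsStationary X (normWeight X φ P h) L)
    (hh : IsEigenfunction X φ P K h) (hX : Set.MapsTo shift X X) {f f' : (ℕ → A) → ℝ}
    (hf : ∃ M, ∀ x ∈ X, |f x| ≤ M) (hf'0 : ∀ x, 0 ≤ f' x) (hf' : ∃ M, ∀ x ∈ X, |f' x| ≤ M)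
    {s : ℕ} {δ c : ℝ} (hc : ∀ x ∈ X, c ≤ (transfer (normWeight X φ P h) ^ s) f x ∧
      (transfer (normWeight X φ P h) ^ s) f x ≤ c + δ) :
    |L (fun z => f z * f' (shift^[s] z)) - L f * L f'| ≤ δ * L f' := by
  obtain ⟨M, hM⟩ := hf
  obtain ⟨M', hM'⟩ := hf'
  have hbt : ∀ x ∈ X, |(transfer (normWeight X φ P h) ^ s) f x| ≤ M := fun x hx =>
    hh.abs_transfer_pow_le hX hM s hx
  have hprod : ∀ g g' : (ℕ → A) → ℝ, ∀ m m' : ℝ, (∀ x ∈ X, |g x| ≤ m) → (∀ x ∈ X, |g' x| ≤ m') →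
      ∀ x ∈ X, |g x * g' x| ≤ m * m' := fun g g' m m' hg hg' x hx => by
    rw [abs_mul]
    exact mul_le_mul (hg x hx) (hg' x hx) (abs_nonneg _) ((abs_nonneg _).trans (hg x hx))
  have hcs := hL.transfer_pow f ⟨M, hM⟩ s
  have hLc : c ≤ L f ∧ L f ≤ c + δ := by
    constructor
    · rw [← hcs, ← hL.const c]
      exact hL.mono _ _ (fun x hx => (hc x hx).1) ⟨|c|, fun _ _ => le_rfl⟩ ⟨M, hbt⟩
    · rw [← hcs, ← hL.const (c + δ)]
      exact hL.mono _ _ (fun x hx => (hc x hx).2) ⟨M, hbt⟩ ⟨|c + δ|, fun _ _ => le_rfl⟩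
  have heq : L (fun z => f z * f' (shift^[s] z)) =
      L (fun z => (transfer (normWeight X φ P h) ^ s) f z * f' z) := by
    rw [← hL.transfer_pow _ ⟨M * M', hprod f (fun z => f' (shift^[s] z)) M M' hM
      fun x hx => hM' _ (hX.iterate s hx)⟩ s]
    congr 1
    funext x
    exact transfer_pow_mul_comp _ _ _ _ _
  have hb : ∃ m, ∀ x ∈ X, |(transfer (normWeight X φ P h) ^ s) f x * f' x| ≤ m :=
    ⟨M * M', hprod _ _ M M' hbt hM'⟩
  have hsmul : ∀ d : ℝ, L (fun z => d * f' z) = d * L f' := fun d => by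
    rw [← smul_eq_mul, ← map_smul]; rfl
  have hbs : ∀ d : ℝ, ∃ m, ∀ x ∈ X, |d * f' x| ≤ m := fun d =>
    ⟨|d| * M', hprod (fun _ => d) f' _ _ (fun _ _ => le_rfl) hM'⟩
  have h0 : 0 ≤ L f' := by
    rw [← hL.const 0]
    exact hL.mono _ _ (fun x _ => hf'0 x) ⟨0, by simp⟩ ⟨M', hM'⟩
  have h₁ : c * L f' ≤ L (fun z => (transfer (normWeight X φ P h) ^ s) f z * f' z) := by
    rw [← hsmul]
    exact hL.mono _ _ (fun x hx => mul_le_mul_of_nonneg_right (hc x hx).1 (hf'0 x)) (hbs c) hb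
  have h₂ : L (fun z => (transfer (normWeight X φ P h) ^ s) f z * f' z) ≤ (c + δ) * L f' := by
    rw [← hsmul]
    exact hL.mono _ _ (fun x hx => mul_le_mul_of_nonneg_right (hc x hx).2 (hf'0 x)) hb (hbs _)
  rw [heq, abs_le]
  constructor <;> nlinarith [hLc.1, hLc.2]

/-- On a sofic subshift with gluing there is a Gibbs measure, and its correlations between
cylinders decay exponentially. -/
lemma exists_isGibbsWith_mixing [TopologicalSpace A] [DiscreteTopology A] [MeasurableSpace A]
    [BorelSpace A] (hX : IsSubshift X) (hne : X.Nonempty) (hsofic : IsSofic X)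
    (hφ : IsHolderWith φ C θ) (hl : IsGluing X l) :
    ∃ (D P : ℝ) (μ : ProbabilityMeasure (ℕ → A)), IsGibbsWith X φ D P μ ∧
      ∃ ρ : ℝ, 0 < ρ ∧ ρ < 1 ∧ ∃ N : ℕ, 0 < N ∧ ∀ (x y : ℕ → A) (m n s : ℕ),
        |(μ : Measure (ℕ → A)).real
            (PiNat.cylinder x m ∩ shift^[s] ⁻¹' PiNat.cylinder y n) -
          (μ : Measure (ℕ → A)).real (PiNat.cylinder x m) *
            (μ : Measure (ℕ → A)).real (PiNat.cylinder y n)| ≤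
        ρ ^ (s / N) * (θ ^ m)⁻¹ * (μ : Measure (ℕ → A)).real (PiNat.cylinder y n) := by
  obtain ⟨P, h, hP, hh, hratio⟩ := exists_isEigenfunction hφ hX.mapsTo hl hne
  obtain ⟨L, hL⟩ := hh.exists_isStationary hX.mapsTo hne
  obtain ⟨μ, hinv, hμ⟩ := hL.exists_measure hh hX
  obtain ⟨y₀, hy₀, q, hsync⟩ := hsofic.exists_synchronising hX hne
  have h1 := sub_pos.2 hφ.lt_one
  have hCV : C ≤ C / (1 - θ) := by
    rw [le_div_iff₀ h1]
    nlinarith [hφ.nonneg, hφ.pos]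
  have hV : IsLogHolder X (C / (1 - θ)) θ h := fun x hx y hy hxy n hn =>
    hratio x hx y hy _ fun k => partition_le_of_samePast hφ k hxy hn
  obtain ⟨ρ, hρ0, hρ1, N, hN, Γ, hΓ, hcontr⟩ :=
    exists_contraction hφ hh hX.mapsTo hCV hV hl hy₀ hsync
  refine ⟨_, P, μ, hL.isGibbsWith hh hX hφ hl hP hinv hμ, ρ, hρ0, hρ1, N, hN,
    fun x y m n s => ?_⟩
  have hθm : 0 ≤ (θ ^ m)⁻¹ := (inv_pos.2 (pow_pos hφ.pos m)).le
  obtain ⟨c, hc⟩ := hcontr _ _ hθm (hasOsc_indicator_cylinder hφ.pos hφ.lt_one x m hΓ) s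
  have hb : ∀ (x : ℕ → A) n, ∃ M : ℝ, ∀ z ∈ X,
      |(PiNat.cylinder (E := fun _ => A) x n).indicator (1 : (ℕ → A) → ℝ) z| ≤ M :=
    fun x n => ⟨1, fun z _ => by
      by_cases hz : z ∈ PiNat.cylinder (E := fun _ => A) x n <;> simp [hz]⟩
  have h0 : ∀ z, 0 ≤ (PiNat.cylinder (E := fun _ => A) y n).indicator (1 : (ℕ → A) → ℝ) z :=
    fun z => Set.indicator_nonneg (fun _ _ => zero_le_one) z
  have key := hL.abs_sub_le hh hX.mapsTo (hb x m) h0 (hb y n) hc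
  have hcx := isClopen_piNat_cylinder x m
  have hcy := isClopen_piNat_cylinder y n
  rw [hμ _ hcx, hμ _ hcy, hμ _ (hcx.inter (hcy.preimage (continuous_shift.iterate s)))]
  convert key using 4
  funext z
  by_cases hz : z ∈ PiNat.cylinder x m <;>
    by_cases hz' : shift^[s] z ∈ PiNat.cylinder y n <;> simp [hz, hz']

end SoficGibbs

theorem theorem3 {A : Type*} [Fintype A] [TopologicalSpace A] [DiscreteTopology A]
    [MeasurableSpace A] [BorelSpace A]
    (X : Set (ℕ → A)) (hne : X.Nonempty) (hX : SoficGibbs.IsSubshift X)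
    (hsofic : SoficGibbs.IsSofic X) (hspec : SoficGibbs.IsSpecified X)
    (φ : (ℕ → A) → ℝ) (hφ : SoficGibbs.IsHolder φ) :
    ∃ (μm : ℕ → ProbabilityMeasure (ℕ → A)) (μs : ProbabilityMeasure (ℕ → A)),
      (∀ m, 1 ≤ m → SoficGibbs.IsGibbs (SoficGibbs.approx X m) φ (μm m) ∧
        ∀ ν, SoficGibbs.IsGibbs (SoficGibbs.approx X m) φ ν → ν = μm m) ∧
      SoficGibbs.IsInvariantOn X μs ∧
      Tendsto μm atTop (𝓝 μs) ∧
      ∃ (Q : Polynomial ℝ) (θ : ℝ), Q.natDegree = 2 ∧ 0 < θ ∧ θ < 1 ∧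
        ∀ a ∈ SoficGibbs.language X, ∀ b ∈ SoficGibbs.language X,
          ∃ s₀ : ℕ, ∀ s : ℕ, s₀ ≤ s →
            |(μs : Measure (ℕ → A)).real
                  (SoficGibbs.cylinder X a ∩ SoficGibbs.shift^[s] ⁻¹' SoficGibbs.cylinder X b) /
                ((μs : Measure (ℕ → A)).real (SoficGibbs.cylinder X a) *
                  (μs : Measure (ℕ → A)).real (SoficGibbs.cylinder X b)) - 1| ≤
              Q.eval (Real.sqrt s) * θ ^ (Real.sqrt s) := by
  open SoficGibbs in
  obtain ⟨C, θ, hφ'⟩ := hφ.exists_isHolderWith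
  obtain ⟨l, hl⟩ := hspec.exists_isWordGluing
  have hXc := hX.isCompact.isClosed
  have hk : ∀ m : ℕ, 1 ≤ max m 1 := fun m => le_max_right _ _
  have hYc : ∀ m, IsClosed (approx X m) := fun m => (isSubshift_approx X m).isCompact.isClosed
  choose P μm hP hμm using fun m => exists_isGibbsWith (isSubshift_approx X (max m 1)) hφ'
    (hl.isGluing_approx hX (hk m)) (hne.mono (hX.subset_approx _))
  obtain ⟨D, Q, μs, hμs, ρ, hρ0, hρ1, N, hN, hmix⟩ :=
    exists_isGibbsWith_mixing hX hne hsofic hφ' (hl.isGluing hX)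
  refine ⟨μm, μs, fun m hm => ?_, hμs.invariantOn, ?_, Polynomial.X ^ 2 + 1, 1 / 2, ?_,
    by norm_num, by norm_num, fun a ha b hb => ?_⟩
  · have h := hμm m
    rw [max_eq_left hm] at h
    refine ⟨(isGibbs_iff (hYc m)).2 ⟨_, _, h⟩, fun ν hν => ?_⟩
    obtain ⟨D', P', hν'⟩ := (isGibbs_iff (hYc m)).1 hν
    exact h.eq (hYc m) hφ' (hl.isGluing_approx hX hm) hν'
  · exact tendsto_of_isGibbsWith_approx hX (hl.isGluing hX) hφ' hP
      (tendsto_atTop_mono (fun m => le_max_left m 1) tendsto_id) hμm hμs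
  · compute_degree!
  · obtain ⟨x, hx, m, -, rfl⟩ := mem_language_iff.1 ha
    obtain ⟨y, hy, n, -, rfl⟩ := mem_language_iff.1 hb
    have hD := one_pos.trans_le hμs.one_le
    have hpos : ∀ x ∈ X, ∀ n, 0 < (μs : Measure (ℕ → A)).real (PiNat.cylinder x n) :=
      fun x hx n => lt_of_lt_of_le (by positivity) (hμs.le_cylinder x hx n)
    have hinter : ∀ s, (μs : Measure (ℕ → A)).real
        (cylinder X (word x 0 m) ∩ shift^[s] ⁻¹' cylinder X (word y 0 n)) =
        (μs : Measure (ℕ → A)).real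
          (PiNat.cylinder x m ∩ shift^[s] ⁻¹' PiNat.cylinder y n) := fun s => by
      rw [cylinder_word, cylinder_word]
      refine measureReal_congr ?_
      filter_upwards [hμs.invariantOn.ae_mem hXc] with z hz
      exact propext ⟨fun h => ⟨h.1.2, h.2.2⟩,
        fun h => ⟨⟨hz, h.1⟩, hX.shift_iterate_mem hz s, h.2⟩⟩
    have hx0 := hpos x hx m
    have hy0 := hpos y hy n
    obtain ⟨s₀, hs₀⟩ := exists_forall_mul_pow_div_le
      ((θ ^ m)⁻¹ / (μs : Measure (ℕ → A)).real (PiNat.cylinder x m)) hρ0 hρ1 hN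
    refine ⟨s₀, fun s hs => ?_⟩
    rw [hinter, hμs.invariantOn.real_cylinder_word hXc, hμs.invariantOn.real_cylinder_word hXc,
      div_sub_one (mul_pos hx0 hy0).ne', abs_div, abs_of_pos (mul_pos hx0 hy0)]
    have h₁ : (1 / 2 : ℝ) ^ Real.sqrt s ≤
        (Polynomial.X ^ 2 + 1 : Polynomial ℝ).eval (Real.sqrt s) * (1 / 2 : ℝ) ^ Real.sqrt s := by
      refine le_mul_of_one_le_left (by positivity) ?_
      simp only [Polynomial.eval_add, Polynomial.eval_pow, Polynomial.eval_X, Polynomial.eval_one]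
      linarith [sq_nonneg (Real.sqrt s)]
    refine le_trans ?_ ((hs₀ s hs).trans h₁)
    rw [div_le_iff₀ (mul_pos hx0 hy0)]
    refine (hmix x y m n s).trans (le_of_eq ?_)
    field_simp
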